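/- Let $n\ge 2$, let $\mathbb P^n=\{z\in\mathbb C^n:\ |z_i|<1,\ i=1,\dots,n\}$, and for $z\in\mathbb P^n$ let $\|v\|_z=\Big(2\sum_{i=1}^n\frac{|v_i|^2}{(1-|z_i|^2)^2}\Big)^{1/2}$ be the Bergman norm of $v\in\mathbb C^n$ at $z$. For a locally biholomorphic $f:\mathbb P^n\to\mathbb C^n$ with Jacobian $J_f=\det Df$ put $$S^k_{ij}f=\sum_{l=1}^n\frac{\partial^2 f_l}{\partial z_i\partial z_j}\frac{\partial z_k}{\partial f_l}-\frac1{n+1}\Big(\delta^k_i\frac{\partial}{\partial z_j}+\delta^k_j\frac{\partial}{\partial z_i}\Big)\log J_f ,$$ where $(\partial z_k/\partial f_l)_{k,l}=(Df)^{-1}$, and $$S_f(z)(v)=\Big(\sum_{i,j}S^k_{ij}f(z)v_iv_j\Big)_{k=1}^n,\qquad \|S_f\|=\sup_{z\in\mathbb P^n}\ \sup_{\|v\|_z=1}\|S_f(z)(v)\|_z .$$ For real $\alpha$ let $\mathcal F_\alpha$ be the set of locally biholomorphic $f:\mathbb P^n\to\mathbb C^n$ with $f(0)=0$, $Df(0)=I$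 and $\|S_f\|\le\alpha$. For $f\in\mathcal F_\alpha$ define $a=(a_1,\dots,a_n)$ by $(n+1)a=\nabla J_f(0)$, and let $$g=\frac{f}{1+a_1f_1+\cdots+a_nf_n}$$ be the normalized map of $f$, a priori with poles where the denominator vanishes; let $\mathcal F_\alpha^0$ be the set of these maps $g$. For every $f\in\mathcal F_\alpha$, the normalized map $g$ is holomorphic on all of $\mathbb P^n$ if and only if $f(\mathbb P^n)$ does not meet the hyperplane $1+a_1w_1+\cdots+a_nw_n=0$. If $n\sqrt n\,\alpha\le \frac1{6.1}$, then every $g\in\mathcal F_\alpha^0$ is holomorphic on $\mathbb P^n$; equivalently, for every $f\in\mathcal F_\alpha$ the image $f(\mathbb P^n)$ does not meet the hyperplane $1+a_1w_1+\cdots+a_nw_n=0$, where $(n+1)a=\nabla J_f(0)$. -/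

import Mathlib

noncomputable section

namespace PolydiskSchwarzian

/-- The open unit polydisk in `ℂⁿ`. -/
def polydisk (n : ℕ) : Set (Fin n → ℂ) := {z | ∀ i, ‖z i‖ < 1}

/-- The complex partial derivative `∂h/∂z_i` of a scalar function of `n` complex variables. -/
def pd {n : ℕ} (i : Fin n) (h : (Fin n → ℂ) → ℂ) (z : Fin n → ℂ) : ℂ :=
  fderiv ℂ h z (Pi.single i 1)

/-- `f` is locally biholomorphic on `Ω`: near every point of `Ω` it restricts to a homeomorphism
between open sets that is holomorphic together with its inverse. -/
def LocallyBiholomorphicOn {n : ℕ} (f : (Fin n → ℂ) → (Fin n → ℂ)) (Ω : Set (Fin n → ℂ)) : Prop :=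
  ∀ z ∈ Ω, ∃ e : OpenPartialHomeomorph (Fin n → ℂ) (Fin n → ℂ),
    z ∈ e.source ∧ e.source ⊆ Ω ∧ Set.EqOn f e e.source ∧
      DifferentiableOn ℂ e e.source ∧ DifferentiableOn ℂ e.symm e.target

/-- The complex Jacobi matrix `Df(z)`, with entry `∂f_l/∂z_i` in row `l` and column `i`. -/
def jacobiMatrix {n : ℕ} (f : (Fin n → ℂ) → (Fin n → ℂ)) (z : Fin n → ℂ) :
    Matrix (Fin n) (Fin n) ℂ :=
  Matrix.of fun l i => pd i (fun w => f w l) z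

/-- The complex Jacobian `J_f = det Df`. -/
def jacobian {n : ℕ} (f : (Fin n → ℂ) → (Fin n → ℂ)) (z : Fin n → ℂ) : ℂ :=
  (jacobiMatrix f z).det

/-- The derivative `∂/∂z_i log J_f`, for any local branch of the logarithm. -/
def pdLogJacobian {n : ℕ} (i : Fin n) (f : (Fin n → ℂ) → (Fin n → ℂ)) (z : Fin n → ℂ) : ℂ :=
  pd i (jacobian f) z / jacobian f z

/-- The Schwarzian derivatives
`S^k_{ij} f = ∑_l (∂²f_l/∂z_i∂z_j) (∂z_k/∂f_l) - (δ^k_i ∂_j + δ^k_j ∂_i) (log J_f) / (n + 1)`.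
Here `∂z_k/∂f_l` is the entry `(k, l)` of the inverse of the Jacobi matrix. -/
def schwarzian {n : ℕ} (k i j : Fin n) (f : (Fin n → ℂ) → (Fin n → ℂ)) (z : Fin n → ℂ) : ℂ :=
  (∑ l, pd i (pd j (fun w => f w l)) z * (jacobiMatrix f z)⁻¹ k l) -
    1 / ((n : ℂ) + 1) *
      ((if k = i then 1 else 0) * pdLogJacobian j f z +
        (if k = j then 1 else 0) * pdLogJacobian i f z)

/-- The Schwarzian operator `S_f(z)`, whose `k`-th component at `v` is `vᵗ S^k_f(z) v`. -/
def schwarzianOp {n : ℕ} (f : (Fin n → ℂ) → (Fin n → ℂ)) (z v : Fin n → ℂ) : Fin n → ℂ :=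
  fun k => ∑ i, ∑ j, v i * schwarzian k i j f z * v j

/-- The Bergman norm of the tangent vector `v` at the point `z` of the polydisk. -/
def bergmanNorm {n : ℕ} (z v : Fin n → ℂ) : ℝ :=
  Real.sqrt (2 * ∑ i, ‖v i‖ ^ 2 / (1 - ‖z i‖ ^ 2) ^ 2)

/-- The norm `‖S_f(z)‖`: the supremum of the Bergman norm of `S_f(z)(v)` over Bergman unit
vectors `v` at `z`. -/
def schwarzianNormAt {n : ℕ} (f : (Fin n → ℂ) → (Fin n → ℂ)) (z : Fin n → ℂ) : EReal :=
  ⨆ v ∈ {v : Fin n → ℂ | bergmanNorm z v = 1}, (bergmanNorm z (schwarzianOp f z v) : EReal)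

/-- The norm `‖S_f‖`, the supremum of `‖S_f(z)‖` over the polydisk (possibly infinite). -/
def schwarzianNorm {n : ℕ} (f : (Fin n → ℂ) → (Fin n → ℂ)) : EReal :=
  ⨆ z ∈ polydisk n, schwarzianNormAt f z

/-- The family `F_α` of locally biholomorphic mappings `f` of the polydisk into `ℂⁿ` with
`f(0) = 0`, `Df(0) = I` and `‖S_f‖ ≤ α`. -/
def family (n : ℕ) (α : ℝ) : Set ((Fin n → ℂ) → (Fin n → ℂ)) :=
  {f | LocallyBiholomorphicOn f (polydisk n) ∧ f 0 = 0 ∧ jacobiMatrix f 0 = 1 ∧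
    schwarzianNorm f ≤ (α : EReal)}

/-- The vector `a` with `(n + 1) a = ∇J_f(0)`. -/
def normVec {n : ℕ} (f : (Fin n → ℂ) → (Fin n → ℂ)) : Fin n → ℂ :=
  fun i => pd i (jacobian f) 0 / ((n : ℂ) + 1)

/-- The complex hyperplane `1 + a₁ w₁ + ⋯ + aₙ wₙ = 0` (empty if `a = 0`). -/
def hyperplane {n : ℕ} (a : Fin n → ℂ) : Set (Fin n → ℂ) := {w | 1 + ∑ i, a i * w i = 0}

/-- The Möbius map `T_a(w) = w / (1 + a₁ w₁ + ⋯ + aₙ wₙ)`, which has its poles on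
`hyperplane a`. -/
def moebius {n : ℕ} (a w : Fin n → ℂ) : Fin n → ℂ :=
  fun k => w k / (1 + ∑ i, a i * w i)

/-- The normalized map `g = T_a ∘ f` with `(n + 1) a = ∇J_f(0)`. It becomes infinite where `f`
meets `hyperplane a`; the value that division by zero assigns to it there is irrelevant, because
`g` cannot be continuous at such a point. -/
def normalized {n : ℕ} (f : (Fin n → ℂ) → (Fin n → ℂ)) (z : Fin n → ℂ) : Fin n → ℂ :=
  moebius (normVec f) (f z)

/-- The family `F_α^0` of the normalized maps of the members of `F_α`, as maps on the polydisk. -/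
def normalizedFamily (n : ℕ) (α : ℝ) : Set ((Fin n → ℂ) → (Fin n → ℂ)) :=
  {g | ∃ f ∈ family n α, Set.EqOn g (normalized f) (polydisk n)}

end PolydiskSchwarzian

end

noncomputable section

open Metric Set Filter Topology

/-! For `i, j ≠ k` the Bergman bound gives `|S^k_ij| ≤ C (1 - |z_k|²)` with `C` independent of
`z_k`, so the maximum principle in `z_k` forces `S^k_ij = 0` (`schwarzian_eq_zero`). Hence `∂_i∂_j
f` lies in the span of `∂_i f` and `∂_j f`, and `f` maps every coordinate disk into a complex line
(`line_eq`).

Write `D = 1 + A ∘ f` for the denominator, `Γ` for the connection coefficients pulled back by `f`,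
and `β = √2 α`. Along the `k`-th disk through `z`, with `z_k = 0`, `D` equals `D(z) μ (1 + Q ψ)`
(`den_update_eq_mul`). Here `μ` has no zeros, because the partial derivatives of `f` form a basis at
every point. The function `ψ` is a Möbius-normalized coordinate on the image line. Its `ψ''/ψ'` is a
combination of Schwarzian coefficients, so `|ψ - t| ≤ 3β` and `|ψ| ≤ 5/4`. Finally `Q` is minus the
coefficient `Γ^s_sk` of the normalized map at `z`. So `D` stays nonzero along the disk as soon as
`|Q| < 4/5`.

Coordinates are switched on one at a time, starting at the origin, where the choice of `a` turns `Q`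
into a Schwarzian coefficient. One index `s` is kept for last. `mixedInv_update` and
`selfInv_update` say how the coefficients of the normalized map change along a disk; only
combinations controlled by the Schwarzian enter, and `invariants_le` runs the resulting recursion.
In the last disk, the required `Q` is recovered from the diagonal coefficient `selfInv`
(`den_ne_zero`).

For the equivalence, a zero of `D` cannot be removable: if `g` is holomorphic there, passing to the
limit in `f = g D` gives `f = 0`, hence `D = 1`. -/

namespace PolydiskSchwarzian

/-! ### Holomorphy of derivatives in several variables -/

/-- A directional derivative of a holomorphic function of several variables is holomorphic. -/
lemma differentiableOn_fderiv_apply {n : ℕ} {U : Set (Fin n → ℂ)} (hU : IsOpen U)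
    {h : (Fin n → ℂ) → ℂ} (hh : DifferentiableOn ℂ h U) (v : Fin n → ℂ) :
    DifferentiableOn ℂ (fun z => fderiv ℂ h z v) U := by
  intro z₀ hz₀
  obtain ⟨R, hR, hRU⟩ := Metric.isOpen_iff.1 hU z₀ hz₀
  set r : ℝ := R / 4 with hr
  have hr0 : 0 < r := by positivity
  have hcU : closedBall z₀ (3 * r) ⊆ U :=
    (closedBall_subset_ball (by rw [hr]; linarith)).trans hRU
  obtain ⟨C, hC⟩ := (isCompact_closedBall z₀ (3 * r)).exists_bound_of_continuousOn
    (hh.continuousOn.mono hcU)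
  have hC0 : 0 ≤ C := (norm_nonneg _).trans (hC z₀ (mem_closedBall_self (by positivity)))
  have hd : ∀ y ∈ U, DifferentiableAt ℂ h y := fun y hy => hh.differentiableAt (hU.mem_nhds hy)
  -- A uniform Cauchy-type bound on the derivative, needed as the dominating constant for
  -- differentiation under the integral sign.
  have hbd : ∀ y ∈ ball z₀ (2 * r), ‖fderiv ℂ h y‖ ≤ (2 * C + 1) / r := by
    intro y hy
    have hsub : ball y r ⊆ closedBall z₀ (3 * r) := by
      intro w hw
      rw [mem_ball] at hy hw
      rw [mem_closedBall]
      linarith [dist_triangle w y z₀]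
    refine Complex.norm_fderiv_le_div_of_mapsTo_ball (hh.mono (hsub.trans hcU)) ?_ hr0
    intro w hw
    rw [mem_closedBall, dist_eq_norm]
    have h1 := hC w (hsub hw)
    have h2 := hC y (hsub (mem_ball_self hr0))
    have h3 := norm_sub_le (h w) (h y)
    linarith
  obtain ⟨ρ, hρ0, hρ⟩ : ∃ ρ : ℝ, 0 < ρ ∧ ρ * ‖v‖ < r := by
    refine ⟨r / (‖v‖ + 1), by positivity, ?_⟩
    have : 0 ≤ ‖v‖ := norm_nonneg _
    rw [div_mul_eq_mul_div, div_lt_iff₀ (by positivity)]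
    nlinarith
  have hin : ∀ w ∈ ball z₀ r, ∀ ζ ∈ closedBall (0 : ℂ) ρ, w + ζ • v ∈ ball z₀ (2 * r) := by
    intro w hw ζ hζ
    rw [mem_ball, dist_eq_norm] at hw ⊢
    rw [mem_closedBall, dist_zero_right] at hζ
    have h1 : ‖ζ • v‖ ≤ ρ * ‖v‖ := by rw [norm_smul]; gcongr
    have h2 : w + ζ • v - z₀ = (w - z₀) + ζ • v := by abel
    rw [h2]
    linarith [norm_add_le (w - z₀) (ζ • v)]
  have h2U : ball z₀ (2 * r) ⊆ U :=
    (ball_subset_closedBall.trans (closedBall_subset_closedBall (by linarith))).trans hcU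
  -- Cauchy's formula for `ζ ↦ h (w + ζ v)` on a circle of fixed radius `ρ`: `w` now enters only
  -- through values of `h`, so one derivative in `w` suffices.
  have key : ∀ w ∈ ball z₀ r, fderiv ℂ h w v =
      (2 * Real.pi * Complex.I)⁻¹ • ∫ θ in (0 : ℝ)..2 * Real.pi,
        (deriv (circleMap 0 ρ) θ * (1 / (circleMap 0 ρ θ - 0) ^ 2)) •
          h (w + circleMap 0 ρ θ • v) := by
    intro w hw
    have hdd : DifferentiableOn ℂ (fun ζ : ℂ => h (w + ζ • v)) (closedBall 0 ρ) := by
      intro ζ hζ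
      have h1 := hd _ (h2U (hin w hw ζ hζ))
      exact (h1.comp ζ (by fun_prop : DifferentiableAt ℂ (fun ζ : ℂ => w + ζ • v) ζ)).differentiableWithinAt
    have h0 : deriv (fun ζ : ℂ => h (w + ζ • v)) 0 = fderiv ℂ h w v := by
      have hw' : DifferentiableAt ℂ h (w + (0 : ℂ) • v) :=
        hd _ (h2U (hin w hw 0 (mem_closedBall_self hρ0.le)))
      have h1 : HasDerivAt (fun ζ : ℂ => w + ζ • v) v 0 := by
        simpa using ((hasDerivAt_id (0 : ℂ)).smul_const v).const_add w
      have := (hw'.hasFDerivAt.comp_hasDerivAt (0 : ℂ) h1).deriv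
      simpa [Function.comp_def] using this
    have h1 := hdd.deriv_eq_smul_circleIntegral hρ0
    rw [← h0]
    have h2 : (2 * (Real.pi : ℂ) * Complex.I) ≠ 0 := by
      simp [Real.pi_ne_zero]
    rw [eq_inv_smul_iff₀ h2, ← h1, circleIntegral]
    simp only [smul_smul]
  have hint : DifferentiableAt ℂ (fun w => ∫ θ in (0 : ℝ)..2 * Real.pi,
        (deriv (circleMap 0 ρ) θ * (1 / (circleMap 0 ρ θ - 0) ^ 2)) •
          h (w + circleMap 0 ρ θ • v)) z₀ := by
    have hcne : ∀ θ, circleMap 0 ρ θ ≠ 0 := fun θ => by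
      simpa using circleMap_ne_center (c := 0) (θ := θ) hρ0.ne'
    have hcm : ∀ θ, circleMap 0 ρ θ ∈ closedBall (0 : ℂ) ρ := fun θ =>
      circleMap_mem_closedBall 0 hρ0.le θ
    have hcont : Continuous (fun θ : ℝ =>
        deriv (circleMap 0 ρ) θ * (1 / (circleMap 0 ρ θ - 0) ^ 2)) := by
      simp only [deriv_circleMap, sub_zero]
      refine Continuous.mul (by fun_prop) (Continuous.div continuous_const (by fun_prop) ?_)
      intro θ
      exact pow_ne_zero 2 (hcne θ)
    have hFc : ∀ w ∈ ball z₀ r, Continuous (fun θ : ℝ =>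
        (deriv (circleMap 0 ρ) θ * (1 / (circleMap 0 ρ θ - 0) ^ 2)) •
          h (w + circleMap 0 ρ θ • v)) := by
      intro w hw
      refine hcont.smul ?_
      rw [continuous_iff_continuousAt]
      intro θ
      exact ContinuousAt.comp (f := fun θ : ℝ => w + circleMap 0 ρ θ • v)
        (hd _ (h2U (hin w hw _ (hcm θ)))).continuousAt (by fun_prop)
    obtain ⟨K, hK⟩ := (isCompact_Icc (a := (0 : ℝ)) (b := 2 * Real.pi)).exists_bound_of_continuousOn
      hcont.continuousOn
    refine HasFDerivAt.differentiableAt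
      (intervalIntegral.hasFDerivAt_integral_of_dominated_of_fderiv_le (𝕜 := ℂ)
        (F' := fun w θ => (deriv (circleMap 0 ρ) θ * (1 / (circleMap 0 ρ θ - 0) ^ 2)) •
          fderiv ℂ h (w + circleMap 0 ρ θ • v)) (bound := fun _ => K * ((2 * C + 1) / r))
        (ball_mem_nhds z₀ hr0) ?_ ?_ ?_ ?_ ?_ ?_)
    · filter_upwards [ball_mem_nhds z₀ hr0] with w hw
      exact (hFc w hw).aestronglyMeasurable
    · exact (hFc z₀ (mem_ball_self hr0)).intervalIntegrable _ _
    · have hm : Measurable (fun θ : ℝ => fderiv ℂ h (z₀ + circleMap 0 ρ θ • v)) :=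
        (measurable_fderiv ℂ h).comp (by fun_prop : Continuous
          (fun θ : ℝ => z₀ + circleMap 0 ρ θ • v)).measurable
      exact (hcont.measurable.smul hm).aestronglyMeasurable
    · refine Eventually.of_forall fun θ hθ w hw => ?_
      rw [uIoc_of_le (by positivity)] at hθ
      rw [norm_smul]
      have h1 := hK θ (Ioc_subset_Icc_self hθ)
      gcongr
      · exact (norm_nonneg _).trans h1
      · exact hbd _ (hin w hw _ (hcm θ))
    · exact intervalIntegrable_const
    · refine Eventually.of_forall fun θ hθ w hw => ?_
      have h1 := (hd _ (h2U (hin w hw _ (hcm θ)))).hasFDerivAt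
      have h2 := h1.comp w ((hasFDerivAt_id w).add_const (circleMap 0 ρ θ • v))
      have h3 : HasFDerivAt (fun x => h (x + circleMap 0 ρ θ • v))
          (fderiv ℂ h (w + circleMap 0 ρ θ • v)) w := by simpa [Function.comp_def] using h2
      exact h3.const_smul (deriv (circleMap 0 ρ) θ * (1 / (circleMap 0 ρ θ - 0) ^ 2))
  refine DifferentiableAt.differentiableWithinAt ?_
  refine (hint.const_smul ((2 * Real.pi * Complex.I)⁻¹ : ℂ)).congr_of_eventuallyEq ?_
  filter_upwards [ball_mem_nhds z₀ hr0] with w hw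
  exact key w hw

lemma differentiableOn_fderiv {n : ℕ} {U : Set (Fin n → ℂ)} (hU : IsOpen U)
    {h : (Fin n → ℂ) → ℂ} (hh : DifferentiableOn ℂ h U) :
    DifferentiableOn ℂ (fderiv ℂ h) U := by
  have : fderiv ℂ h = fun z => ∑ i, fderiv ℂ h z (Pi.single i 1) •
      (ContinuousLinearMap.proj i : (Fin n → ℂ) →L[ℂ] ℂ) := by
    funext z
    ext v
    simp only [sum_apply, smul_apply,
      ContinuousLinearMap.proj_apply, smul_eq_mul]
    conv_lhs => rw [pi_eq_sum_univ' v]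
    rw [map_sum]
    refine Finset.sum_congr rfl fun i _ => ?_
    rw [map_smul, smul_eq_mul, mul_comm]
  rw [this]
  refine DifferentiableOn.fun_sum fun i _ => ?_
  exact (differentiableOn_fderiv_apply hU hh _).smul_const _

/-! ### Calculus of coordinate derivatives -/

/-- The derivative of a vector valued function in the direction of the `i`-th coordinate. -/
def dirDeriv {n m : ℕ} (i : Fin n) (F : (Fin n → ℂ) → (Fin m → ℂ)) (z : Fin n → ℂ) : Fin m → ℂ :=
  fderiv ℂ F z (Pi.single i 1)

section rules

variable {n m : ℕ} {U : Set (Fin n → ℂ)}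

lemma differentiableOn_pd (hU : IsOpen U) {h : (Fin n → ℂ) → ℂ} (hh : DifferentiableOn ℂ h U)
    (i : Fin n) : DifferentiableOn ℂ (pd i h) U :=
  differentiableOn_fderiv_apply hU hh _

lemma pd_apply_eq_dirDeriv {F : (Fin n → ℂ) → (Fin m → ℂ)} {z : Fin n → ℂ}
    (hF : DifferentiableAt ℂ F z) (i : Fin n) (l : Fin m) :
    pd i (fun w => F w l) z = dirDeriv i F z l := by
  rw [pd, dirDeriv]
  have := (hasFDerivAt_pi'.1 hF.hasFDerivAt l).fderiv
  rw [this]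
  rfl

lemma differentiableOn_dirDeriv (hU : IsOpen U) {F : (Fin n → ℂ) → (Fin m → ℂ)}
    (hF : DifferentiableOn ℂ F U) (i : Fin n) : DifferentiableOn ℂ (dirDeriv i F) U := by
  rw [differentiableOn_pi]
  intro l
  have h1 := differentiableOn_pd hU (differentiableOn_pi.1 hF l) i
  refine h1.congr fun z hz => ?_
  exact (pd_apply_eq_dirDeriv (hF.differentiableAt (hU.mem_nhds hz)) i l).symm

lemma pd_comm (hU : IsOpen U) {h : (Fin n → ℂ) → ℂ} (hh : DifferentiableOn ℂ h U)
    {z : Fin n → ℂ} (hz : z ∈ U) (i j : Fin n) : pd i (pd j h) z = pd j (pd i h) z := by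
  have hd : DifferentiableAt ℂ (fderiv ℂ h) z :=
    (differentiableOn_fderiv hU hh).differentiableAt (hU.mem_nhds hz)
  have hev : ∀ᶠ y in 𝓝 z, HasFDerivAt h (fderiv ℂ h y) y := by
    filter_upwards [hU.mem_nhds hz] with y hy
    exact (hh.differentiableAt (hU.mem_nhds hy)).hasFDerivAt
  have hs := second_derivative_symmetric_of_eventually hev hd.hasFDerivAt
  have aux : ∀ a b : Fin n, pd a (pd b h) z =
      fderiv ℂ (fderiv ℂ h) z (Pi.single a 1) (Pi.single b 1) := by
    intro a b
    have := (hd.hasFDerivAt.clm_apply (hasFDerivAt_const (Pi.single b (1 : ℂ)) z)).fderiv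
    unfold pd
    rw [this]
    simp
  rw [aux, aux]
  exact hs _ _

lemma dirDeriv_comm (hU : IsOpen U) {F : (Fin n → ℂ) → (Fin m → ℂ)} (hF : DifferentiableOn ℂ F U)
    {z : Fin n → ℂ} (hz : z ∈ U) (i j : Fin n) :
    dirDeriv i (dirDeriv j F) z = dirDeriv j (dirDeriv i F) z := by
  have aux : ∀ a b : Fin n, ∀ l, dirDeriv a (dirDeriv b F) z l =
      pd a (pd b (fun w => F w l)) z := by
    intro a b l
    rw [← pd_apply_eq_dirDeriv
      ((differentiableOn_dirDeriv hU hF b).differentiableAt (hU.mem_nhds hz))]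
    unfold pd
    refine congrArg (fun L : (Fin n → ℂ) →L[ℂ] ℂ => L _) (Filter.EventuallyEq.fderiv_eq ?_)
    filter_upwards [hU.mem_nhds hz] with y hy
    exact (pd_apply_eq_dirDeriv (hF.differentiableAt (hU.mem_nhds hy)) b l).symm
  funext l
  rw [aux, aux]
  exact pd_comm hU (differentiableOn_pi.1 hF l) hz i j

lemma pd_congr {g h : (Fin n → ℂ) → ℂ} {z : Fin n → ℂ} (hgh : g =ᶠ[𝓝 z] h)
    (i : Fin n) : pd i g z = pd i h z := by
  unfold pd
  rw [hgh.fderiv_eq]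

lemma pd_mul {g h : (Fin n → ℂ) → ℂ} {z : Fin n → ℂ} (hg : DifferentiableAt ℂ g z)
    (hh : DifferentiableAt ℂ h z) (i : Fin n) :
    pd i (fun w => g w * h w) z = pd i g z * h z + g z * pd i h z := by
  unfold pd
  rw [fderiv_fun_mul hg hh]
  simp; ring

lemma pd_sub {g h : (Fin n → ℂ) → ℂ} {z : Fin n → ℂ} (hg : DifferentiableAt ℂ g z)
    (hh : DifferentiableAt ℂ h z) (i : Fin n) :
    pd i (fun w => g w - h w) z = pd i g z - pd i h z := by
  unfold pd
  rw [fderiv_fun_sub hg hh]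
  simp

lemma pd_const_mul {h : (Fin n → ℂ) → ℂ} {z : Fin n → ℂ} (c : ℂ)
    (hh : DifferentiableAt ℂ h z) (i : Fin n) :
    pd i (fun w => c * h w) z = c * pd i h z := by
  unfold pd
  rw [fderiv_const_mul hh]
  simp

lemma pd_div {g h : (Fin n → ℂ) → ℂ} {z : Fin n → ℂ} (hg : DifferentiableAt ℂ g z)
    (hh : DifferentiableAt ℂ h z) (h0 : h z ≠ 0) (i : Fin n) :
    pd i (fun w => g w / h w) z = (pd i g z * h z - g z * pd i h z) / h z ^ 2 := by
  have hev : ∀ᶠ w in 𝓝 z, g w = g w / h w * h w := by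
    filter_upwards [hh.continuousAt.eventually_ne h0] with w hw
    field_simp
  have h1 := pd_congr hev i
  rw [pd_mul (by simpa only [div_eq_mul_inv] using hg.fun_mul (hh.fun_inv h0)) hh i] at h1
  rw [h1]
  field_simp
  ring

lemma dirDeriv_add {F G : (Fin n → ℂ) → (Fin m → ℂ)} {z : Fin n → ℂ}
    (hF : DifferentiableAt ℂ F z) (hG : DifferentiableAt ℂ G z) (i : Fin n) :
    dirDeriv i (fun w => F w + G w) z = dirDeriv i F z + dirDeriv i G z := by
  unfold dirDeriv
  rw [fderiv_fun_add hF hG]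
  simp

lemma dirDeriv_smul {g : (Fin n → ℂ) → ℂ} {F : (Fin n → ℂ) → (Fin m → ℂ)} {z : Fin n → ℂ}
    (hg : DifferentiableAt ℂ g z) (hF : DifferentiableAt ℂ F z) (i : Fin n) :
    dirDeriv i (fun w => g w • F w) z = pd i g z • F z + g z • dirDeriv i F z := by
  unfold dirDeriv pd
  rw [fderiv_fun_smul hg hF]
  simp [add_comm]

lemma dirDeriv_congr {F G : (Fin n → ℂ) → (Fin m → ℂ)} {z : Fin n → ℂ} (h : F =ᶠ[𝓝 z] G)
    (i : Fin n) : dirDeriv i F z = dirDeriv i G z := by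
  unfold dirDeriv
  rw [h.fderiv_eq]

lemma hasDerivAt_dirDeriv {F : (Fin n → ℂ) → (Fin m → ℂ)} {z : Fin n → ℂ} {i : Fin n} {t : ℂ}
    (hF : DifferentiableAt ℂ F (Function.update z i t)) :
    HasDerivAt (fun s => F (Function.update z i s)) (dirDeriv i F (Function.update z i t)) t :=
  hF.hasFDerivAt.comp_hasDerivAt t (hasDerivAt_update z i t)

lemma hasDerivAt_pd {h : (Fin n → ℂ) → ℂ} {z : Fin n → ℂ} {i : Fin n} {t : ℂ}
    (hh : DifferentiableAt ℂ h (Function.update z i t)) :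
    HasDerivAt (fun s => h (Function.update z i s)) (pd i h (Function.update z i t)) t :=
  hh.hasFDerivAt.comp_hasDerivAt t (hasDerivAt_update z i t)

end rules

/-! ### One-variable estimates on the unit disk -/

/-- The Cauchy estimate at the centre of the unit disk for a function bounded on the disk. -/
lemma norm_deriv_zero_le {g : ℂ → ℂ} {C : ℝ} (hg : DifferentiableOn ℂ g (ball 0 1))
    (hC : ∀ t ∈ ball (0 : ℂ) 1, ‖g t‖ ≤ C) : ‖deriv g 0‖ ≤ C := by
  have h1 : ∀ r ∈ Ioo (0 : ℝ) 1, r * ‖deriv g 0‖ ≤ C := by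
    intro r hr
    have := Complex.norm_deriv_le_of_forall_mem_sphere_norm_le (c := 0) (f := g) (C := C) hr.1
      ((hg.mono (by
        rw [closure_ball _ hr.1.ne']
        exact closedBall_subset_ball hr.2)).diffContOnCl)
      (fun z hz => hC z (by
        rw [mem_sphere, dist_zero_right] at hz
        rw [mem_ball, dist_zero_right, hz]
        exact hr.2))
    rw [le_div_iff₀ hr.1] at this
    linarith
  have h2 : Tendsto (fun r : ℝ => r * ‖deriv g 0‖) (𝓝[<] 1) (𝓝 (1 * ‖deriv g 0‖)) :=
    ((continuous_id.mul continuous_const).tendsto 1).mono_left nhdsWithin_le_nhds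
  rw [one_mul] at h2
  refine le_of_tendsto h2 ?_
  filter_upwards [Ioo_mem_nhdsLT (zero_lt_one' ℝ)] with r hr using h1 r hr

/-- Cauchy's estimate in the `i`-th variable loses nothing at the centre of the disk. This is why
coordinates not yet switched on are kept at zero. -/
lemma norm_pd_le {n : ℕ} {U : Set (Fin n → ℂ)} (hU : IsOpen U) {h : (Fin n → ℂ) → ℂ}
    (hh : DifferentiableOn ℂ h U) {z : Fin n → ℂ} {i : Fin n} (hzi : z i = 0) {C : ℝ}
    (hzU : ∀ t ∈ ball (0 : ℂ) 1, Function.update z i t ∈ U)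
    (hC : ∀ t ∈ ball (0 : ℂ) 1, ‖h (Function.update z i t)‖ ≤ C) : ‖pd i h z‖ ≤ C := by
  have hd : ∀ t ∈ ball (0 : ℂ) 1, HasDerivAt (fun s => h (Function.update z i s))
      (pd i h (Function.update z i t)) t := fun t ht =>
    hasDerivAt_pd (hh.differentiableAt (hU.mem_nhds (hzU t ht)))
  have h0 := (hd 0 (mem_ball_self one_pos)).deriv
  have hz : Function.update z i 0 = z := by rw [← hzi, Function.update_eq_self]
  rw [hz] at h0
  rw [← h0]
  exact norm_deriv_zero_le (fun t ht => (hd t ht).differentiableAt.differentiableWithinAt) hC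

lemma eqOn_const_of_hasDerivAt_zero {F : ℂ → ℂ} (hF : ∀ t ∈ ball (0 : ℂ) 1, HasDerivAt F 0 t)
    {s t : ℂ} (hs : s ∈ ball (0 : ℂ) 1) (ht : t ∈ ball (0 : ℂ) 1) : F s = F t := by
  have := (convex_ball (0 : ℂ) 1).norm_image_sub_le_of_norm_hasDerivWithin_le (f := F)
    (f' := fun _ => 0) (C := 0) (fun x hx => (hF x hx).hasDerivWithinAt) (by simp) ht hs
  rw [zero_mul] at this
  exact sub_eq_zero.1 (norm_le_zero_iff.1 this)

/-- Solutions of a homogeneous linear scalar equation on the disk are exponentials of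
primitives. -/
lemma exists_primitive_of_linear {κ R : ℂ → ℂ} (hκ : DifferentiableOn ℂ κ (ball 0 1))
    (hR : ∀ t ∈ ball (0 : ℂ) 1, HasDerivAt R (κ t * R t) t) {a : ℂ} (ha : a ∈ ball (0 : ℂ) 1) :
    ∃ P : ℂ → ℂ, P a = 0 ∧ (∀ t ∈ ball (0 : ℂ) 1, HasDerivAt P (κ t) t) ∧
      ∀ t ∈ ball (0 : ℂ) 1, R t = R a * Complex.exp (P t) := by
  obtain ⟨P, hPa, hP⟩ := hκ.isExactOn_ball.with_val_at a 0
  refine ⟨P, hPa, hP, fun t ht => ?_⟩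
  have h1 : ∀ s ∈ ball (0 : ℂ) 1, HasDerivAt (fun s => R s * Complex.exp (-P s)) 0 s := by
    intro s hs
    have := (hR s hs).fun_mul (hP s hs).fun_neg.cexp
    refine this.congr_deriv ?_
    ring
  have h2 := eqOn_const_of_hasDerivAt_zero h1 ht ha
  simp only [hPa, neg_zero, Complex.exp_zero, mul_one] at h2
  rw [← h2, mul_assoc, ← Complex.exp_add, neg_add_cancel, Complex.exp_zero, mul_one]

lemma eq_zero_of_linear {κ R : ℂ → ℂ} (hκ : DifferentiableOn ℂ κ (ball 0 1))
    (hR : ∀ t ∈ ball (0 : ℂ) 1, HasDerivAt R (κ t * R t) t) {a : ℂ} (ha : a ∈ ball (0 : ℂ) 1)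
    (hRa : R a = 0) {t : ℂ} (ht : t ∈ ball (0 : ℂ) 1) : R t = 0 := by
  obtain ⟨P, -, -, h⟩ := exists_primitive_of_linear hκ hR ha
  rw [h t ht, hRa, zero_mul]

/-- Integration along the ray from `0` to `t`, with a radial majorant of the derivative. -/
lemma norm_le_of_radial {F F' : ℂ → ℂ} {B B' : ℝ → ℝ}
    (hF : ∀ t ∈ ball (0 : ℂ) 1, HasDerivAt F (F' t) t) (hF0 : F 0 = 0) (hB0 : 0 ≤ B 0)
    (hB : ∀ x ∈ Ico (0 : ℝ) 1, HasDerivAt B (B' x) x)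
    (h : ∀ t ∈ ball (0 : ℂ) 1, ‖F' t‖ ≤ B' ‖t‖) {t : ℂ} (ht : t ∈ ball (0 : ℂ) 1) :
    ‖F t‖ ≤ B ‖t‖ := by
  rcases eq_or_ne t 0 with rfl | ht0
  · simpa [hF0] using hB0
  set r := ‖t‖ with hr
  have hr0 : 0 < r := norm_pos_iff.2 ht0
  have hr1 : r < 1 := by simpa using ht
  set u : ℂ := t / r with hu
  have hrc : (r : ℂ) ≠ 0 := by exact_mod_cast hr0.ne'
  have hun : ‖u‖ = 1 := by
    rw [hu, norm_div, Complex.norm_real, Real.norm_of_nonneg hr0.le, ← hr, div_self hr0.ne']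
  have hn : ∀ x ∈ Icc 0 r, ‖(x : ℂ) * u‖ = x := by
    intro x hx
    rw [norm_mul, hun, mul_one, Complex.norm_real, Real.norm_of_nonneg hx.1]
  have hmem : ∀ x ∈ Icc 0 r, (x : ℂ) * u ∈ ball (0 : ℂ) 1 := by
    intro x hx
    rw [mem_ball, dist_zero_right, hn x hx]
    exact hx.2.trans_lt hr1
  have hd : ∀ x ∈ Icc 0 r, HasDerivAt (fun x : ℝ => F (x * u)) (F' (x * u) * u) x := by
    intro x hx
    have h1 : HasDerivAt (fun x : ℝ => (x : ℂ) * u) u x := by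
      simpa using (Complex.ofRealCLM.hasDerivAt (x := x)).mul_const u
    exact (hF _ (hmem x hx)).comp x h1
  have key := image_norm_le_of_norm_deriv_right_le_deriv_boundary' (a := 0) (b := r)
    (f := fun x : ℝ => F (x * u)) (f' := fun x : ℝ => F' (x * u) * u) (B := B) (B' := B')
    (fun x hx => (hd x hx).continuousAt.continuousWithinAt)
    (fun x hx => (hd x (Ico_subset_Icc_self hx)).hasDerivWithinAt)
    (by simpa [hF0] using hB0)
    (fun x hx => (hB x ⟨hx.1, hx.2.trans_lt hr1⟩).continuousAt.continuousWithinAt)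
    (fun x hx => (hB x ⟨hx.1, hx.2.trans hr1⟩).hasDerivWithinAt)
    (fun x hx => by
      have h1 := h _ (hmem x (Ico_subset_Icc_self hx))
      rw [hn x (Ico_subset_Icc_self hx)] at h1
      rwa [norm_mul, hun, mul_one])
  have := key (right_mem_Icc.2 hr0.le)
  rwa [hu, mul_div_cancel₀ _ hrc] at this

lemma norm_exp_sub_one_le_exp_norm (z : ℂ) : ‖Complex.exp z - 1‖ ≤ Real.exp ‖z‖ - 1 := by
  simpa using Complex.norm_exp_sub_sum_le_exp_norm_sub_sum z 1

/-- To first order the left side is `(1 + log 2) c`, about `1.69 c`; the range of `c` leaves room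
for the quadratic terms. The endpoint is `3/2 · 1/12.2`, the largest value of `3β/2`. -/
lemma exp_mul_log_two_le {c : ℝ} (hc0 : 0 ≤ c) (hc : c ≤ 3 / 24.4) :
    Real.exp (c * Real.log 2) / (1 - c) - 1 ≤ 2 * c := by
  have hl := Real.log_two_lt_d9
  have hl0 := Real.log_two_gt_d9
  have hx0 : 0 ≤ c * Real.log 2 := by positivity
  have hx1 : c * Real.log 2 ≤ c * 0.6932 := by gcongr; linarith
  have h1 : Real.exp (c * Real.log 2) ≤ 1 + c * Real.log 2 + (c * Real.log 2) ^ 2 := by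
    have h2 := Real.norm_exp_sub_one_sub_id_le (x := c * Real.log 2)
      (by rw [Real.norm_of_nonneg hx0]; norm_num at hc; linarith)
    rw [Real.norm_of_nonneg hx0] at h2
    have h3 := (Real.le_norm_self _).trans h2
    linarith
  have h4 : (c * Real.log 2) ^ 2 ≤ (c * 0.6932) ^ 2 := by gcongr
  norm_num at hc
  rw [sub_le_iff_le_add, div_le_iff₀ (by linarith)]
  nlinarith

/-- A distortion estimate: if `ψ'' / ψ'` is bounded by `2 c / (1 - |t|²)` and `ψ` is normalized at
the origin, then `ψ` differs from the identity by at most `2 c`. -/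
lemma norm_sub_id_le {κ R ψ : ℂ → ℂ} {c : ℝ} (hc0 : 0 ≤ c) (hc : c ≤ 3 / 24.4)
    (hκ : DifferentiableOn ℂ κ (ball 0 1))
    (hκb : ∀ t ∈ ball (0 : ℂ) 1, ‖κ t‖ ≤ 2 * c / (1 - ‖t‖ ^ 2))
    (hR : ∀ t ∈ ball (0 : ℂ) 1, HasDerivAt R (κ t * R t) t) (hR0 : R 0 = 1)
    (hψ : ∀ t ∈ ball (0 : ℂ) 1, HasDerivAt ψ (R t) t) (hψ0 : ψ 0 = 0) {t : ℂ}
    (ht : t ∈ ball (0 : ℂ) 1) : ‖ψ t - t‖ ≤ 2 * c := by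
  have h0 : (0 : ℂ) ∈ ball (0 : ℂ) 1 := mem_ball_self one_pos
  obtain ⟨P, hP0, hP, hRP⟩ := exists_primitive_of_linear hκ hR h0
  have hc1 : c < 1 := by norm_num at hc; linarith
  have hPb : ∀ t ∈ ball (0 : ℂ) 1,
      ‖P t‖ ≤ c * (Real.log (1 + ‖t‖) - Real.log (1 - ‖t‖)) := by
    intro t ht
    refine norm_le_of_radial (B := fun x => c * (Real.log (1 + x) - Real.log (1 - x)))
      (B' := fun x => 2 * c / (1 - x ^ 2)) hP hP0 (by simp) ?_ hκb ht
    intro x hx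
    have h1 : (1 + x) ≠ 0 := by linarith [hx.1]
    have h2 : (1 - x) ≠ 0 := by linarith [hx.2]
    have h3 : (1 - x ^ 2) ≠ 0 := by
      have : 1 - x ^ 2 = (1 + x) * (1 - x) := by ring
      rw [this]; exact mul_ne_zero h1 h2
    have h4 := ((((hasDerivAt_id x).const_add 1).log h1).sub
      (((hasDerivAt_id x).const_sub 1).log h2)).const_mul c
    refine h4.congr_deriv ?_
    simp only [id_eq]
    field_simp
    ring
  set E := Real.exp (c * Real.log 2) with hE
  have hE0 : 0 < E := Real.exp_pos _
  have hRb : ∀ t ∈ ball (0 : ℂ) 1,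
      ‖R t - 1‖ ≤ E * Real.exp (-c * Real.log (1 - ‖t‖)) - 1 := by
    intro t ht
    have ht1 : ‖t‖ < 1 := by simpa using ht
    rw [hRP t ht, hR0, one_mul]
    refine (norm_exp_sub_one_le_exp_norm _).trans ?_
    rw [hE, ← Real.exp_add]
    gcongr
    refine (hPb t ht).trans ?_
    have : Real.log (1 + ‖t‖) ≤ Real.log 2 :=
      Real.log_le_log (by linarith [norm_nonneg t]) (by linarith)
    nlinarith
  -- The majorant `B` is the primitive of `2^c (1 - x)^(-c) - 1` that vanishes at `0`.
  have hfin := norm_le_of_radial (F := fun t => ψ t - t) (F' := fun t => R t - 1)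
    (B := fun x => E / (1 - c) * (1 - Real.exp ((1 - c) * Real.log (1 - x))) - x)
    (B' := fun x => E * Real.exp (-c * Real.log (1 - x)) - 1)
    (fun t ht => (hψ t ht).sub (hasDerivAt_id t)) (by simp [hψ0]) (by simp) ?_ hRb ht
  · refine hfin.trans ?_
    have ht1 : ‖t‖ < 1 := by simpa using ht
    have hn := norm_nonneg t
    have hlog : Real.log (1 - ‖t‖) ≤ 0 := Real.log_nonpos (by linarith) (by linarith)
    -- Since `1 - c ≤ 1`, `(1 - x)^(1 - c) ≥ 1 - x`; the bound becomes `(2^c / (1 - c) - 1) x`,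
    -- which is at most `2 c x`.
    have h1 : 1 - ‖t‖ ≤ Real.exp ((1 - c) * Real.log (1 - ‖t‖)) := by
      conv_lhs => rw [← Real.exp_log (by linarith : (0 : ℝ) < 1 - ‖t‖)]
      gcongr
      nlinarith
    have h2 := exp_mul_log_two_le hc0 hc
    rw [← hE] at h2
    have h3 : E / (1 - c) * (1 - Real.exp ((1 - c) * Real.log (1 - ‖t‖))) ≤ E / (1 - c) * ‖t‖ := by
      have : 0 < 1 - c := by linarith
      gcongr
      linarith
    have h4 : E / (1 - c) * ‖t‖ - ‖t‖ ≤ 2 * c * ‖t‖ := by nlinarith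
    show E / (1 - c) * (1 - Real.exp ((1 - c) * Real.log (1 - ‖t‖))) - ‖t‖ ≤ 2 * c
    nlinarith
  · intro x hx
    have h2 : 0 < 1 - x := by linarith [hx.2]
    have h3 : 1 - c ≠ 0 := by linarith
    have h4 := ((((((hasDerivAt_id x).const_sub 1).log h2.ne').const_mul (1 - c)).exp.const_sub
      1).const_mul (E / (1 - c))).sub (hasDerivAt_id x)
    refine h4.congr_deriv ?_
    have h5 : Real.exp ((1 - c) * Real.log (1 - x)) =
        (1 - x) * Real.exp (-c * Real.log (1 - x)) := by
      conv_rhs => rw [← Real.exp_log h2]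
      rw [Real.log_exp, ← Real.exp_add]
      congr 1; ring
    simp only [id]
    rw [h5]
    field_simp

/-- The maximum principle on the circles of radius `r`, as `r` tends to `1`. -/
lemma eq_zero_of_norm_le_one_sub_sq {h : ℂ → ℂ} {C : ℝ} (hd : DifferentiableOn ℂ h (ball 0 1))
    (hC : ∀ t ∈ ball (0 : ℂ) 1, ‖h t‖ ≤ C * (1 - ‖t‖ ^ 2)) {t : ℂ} (ht : t ∈ ball (0 : ℂ) 1) :
    h t = 0 := by
  have ht1 : ‖t‖ < 1 := by simpa using ht
  have h1 : ∀ r ∈ Ioo ‖t‖ 1, ‖h t‖ ≤ C * (1 - r ^ 2) := by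
    intro r hr
    have hr0 : 0 < r := (norm_nonneg t).trans_lt hr.1
    refine Complex.norm_le_of_forall_mem_frontier_norm_le (U := ball (0 : ℂ) r) isBounded_ball
      ((hd.mono ?_).diffContOnCl) ?_ (subset_closure (by simpa using hr.1))
    · rw [closure_ball _ hr0.ne']
      exact closedBall_subset_ball hr.2
    · intro z hz
      rw [frontier_ball _ hr0.ne', mem_sphere, dist_zero_right] at hz
      have := hC z (by rw [mem_ball, dist_zero_right, hz]; exact hr.2)
      rwa [hz] at this
  have h2 : Tendsto (fun r : ℝ => C * (1 - r ^ 2)) (𝓝[<] 1) (𝓝 (C * (1 - 1 ^ 2))) :=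
    ((by fun_prop : Continuous (fun r : ℝ => C * (1 - r ^ 2))).tendsto 1).mono_left
      nhdsWithin_le_nhds
  have h3 : ‖h t‖ ≤ C * (1 - 1 ^ 2) := by
    refine ge_of_tendsto h2 ?_
    filter_upwards [Ioo_mem_nhdsLT ht1] with r hr using h1 r hr
  rw [one_pow, sub_self, mul_zero] at h3
  exact norm_le_zero_iff.1 h3

/-! ### The polydisk and locally biholomorphic maps -/

variable {n : ℕ}

lemma isOpen_polydisk : IsOpen (polydisk n) := by
  have : polydisk n = ⋂ i, {z : Fin n → ℂ | ‖z i‖ < 1} := by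
    ext z; simp [polydisk]
  rw [this]
  exact isOpen_iInter_of_finite fun i => isOpen_lt (by fun_prop) continuous_const

lemma update_mem_polydisk {z : Fin n → ℂ} (hz : z ∈ polydisk n) (k : Fin n) {t : ℂ}
    (ht : t ∈ ball (0 : ℂ) 1) : Function.update z k t ∈ polydisk n := by
  intro i
  rcases eq_or_ne i k with rfl | h
  · simpa using ht
  · simpa [Function.update_of_ne h] using hz i

lemma weight_pos {z : Fin n → ℂ} (hz : z ∈ polydisk n) (i : Fin n) : 0 < 1 - ‖z i‖ ^ 2 := by
  have := hz i
  have h0 := norm_nonneg (z i)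
  nlinarith

section local_biholomorphic

variable {f : (Fin n → ℂ) → (Fin n → ℂ)}

lemma LocallyBiholomorphicOn.differentiableOn {Ω : Set (Fin n → ℂ)}
    (hf : LocallyBiholomorphicOn f Ω) : DifferentiableOn ℂ f Ω := by
  intro z hz
  obtain ⟨e, hze, -, heq, hd, -⟩ := hf z hz
  have h1 : DifferentiableAt ℂ e z := hd.differentiableAt (e.open_source.mem_nhds hze)
  refine (h1.congr_of_eventuallyEq ?_).differentiableWithinAt
  filter_upwards [e.open_source.mem_nhds hze] with w hw using heq hw

lemma jacobiMatrix_eq_toMatrix {z : Fin n → ℂ} (hf : DifferentiableAt ℂ f z) :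
    jacobiMatrix f z = LinearMap.toMatrix' (fderiv ℂ f z : (Fin n → ℂ) →ₗ[ℂ] (Fin n → ℂ)) := by
  ext l i
  rw [LinearMap.toMatrix'_apply, jacobiMatrix, Matrix.of_apply, pd_apply_eq_dirDeriv hf]
  simp [dirDeriv]

lemma LocallyBiholomorphicOn.jacobian_ne_zero {Ω : Set (Fin n → ℂ)}
    (hf : LocallyBiholomorphicOn f Ω) {z : Fin n → ℂ} (hz : z ∈ Ω) : jacobian f z ≠ 0 := by
  obtain ⟨e, hze, -, heq, hd, hd'⟩ := hf z hz
  have h1 : DifferentiableAt ℂ e z := hd.differentiableAt (e.open_source.mem_nhds hze)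
  have hev : f =ᶠ[𝓝 z] e := by
    filter_upwards [e.open_source.mem_nhds hze] with w hw using heq hw
  have h2 : DifferentiableAt ℂ e.symm (e z) :=
    hd'.differentiableAt (e.open_target.mem_nhds (e.map_source hze))
  have hfz : DifferentiableAt ℂ f z := h1.congr_of_eventuallyEq hev
  have h3 : (fderiv ℂ e.symm (e z)).comp (fderiv ℂ e z) = ContinuousLinearMap.id ℂ _ := by
    rw [← fderiv_comp z h2 h1]
    have : e.symm ∘ e =ᶠ[𝓝 z] id := by
      filter_upwards [e.open_source.mem_nhds hze] with w hw using e.left_inv hw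
    rw [this.fderiv_eq, fderiv_id]
  rw [jacobian, jacobiMatrix_eq_toMatrix hfz, hev.fderiv_eq]
  have h4 : LinearMap.toMatrix' (fderiv ℂ e.symm (e z) : (Fin n → ℂ) →ₗ[ℂ] (Fin n → ℂ)) *
      LinearMap.toMatrix' (fderiv ℂ e z : (Fin n → ℂ) →ₗ[ℂ] (Fin n → ℂ)) = 1 := by
    rw [← LinearMap.toMatrix'_comp, ← LinearMap.toMatrix'_id]
    congr 1
    ext1 i
    exact congrArg (fun L : (Fin n → ℂ) →L[ℂ] (Fin n → ℂ) => L.toLinearMap ∘ₗ _) h3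
  exact Matrix.det_ne_zero_of_left_inverse h4

lemma differentiableOn_det {U : Set (Fin n → ℂ)} {A : (Fin n → ℂ) → Matrix (Fin n) (Fin n) ℂ}
    (hA : ∀ i j, DifferentiableOn ℂ (fun z => A z i j) U) :
    DifferentiableOn ℂ (fun z => (A z).det) U := by
  simp only [Matrix.det_apply]
  refine DifferentiableOn.fun_sum fun σ _ => ?_
  refine DifferentiableOn.const_smul ?_ _
  intro z hz
  exact (HasFDerivWithinAt.finsetProd fun i _ =>
    (hA (σ i) i z hz).hasFDerivWithinAt).differentiableWithinAt

lemma differentiableOn_jacobiMatrix (hf : DifferentiableOn ℂ f (polydisk n)) (l i : Fin n) :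
    DifferentiableOn ℂ (fun z => jacobiMatrix f z l i) (polydisk n) :=
  differentiableOn_pd isOpen_polydisk (differentiableOn_pi.1 hf l) i

lemma differentiableOn_jacobian (hf : DifferentiableOn ℂ f (polydisk n)) :
    DifferentiableOn ℂ (jacobian f) (polydisk n) :=
  differentiableOn_det fun l i => differentiableOn_jacobiMatrix hf l i

lemma LocallyBiholomorphicOn.differentiableOn_inv_jacobiMatrix
    (hf : LocallyBiholomorphicOn f (polydisk n)) (k l : Fin n) :
    DifferentiableOn ℂ (fun z => (jacobiMatrix f z)⁻¹ k l) (polydisk n) := by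
  have hd := hf.differentiableOn
  have h1 : ∀ z ∈ polydisk n, (jacobiMatrix f z)⁻¹ k l =
      (jacobian f z)⁻¹ * ((jacobiMatrix f z).updateRow l (Pi.single k 1)).det := by
    intro z _
    rw [Matrix.inv_def, Matrix.smul_apply, Matrix.adjugate_apply, Ring.inverse_eq_inv', smul_eq_mul,
      jacobian]
  refine DifferentiableOn.congr ?_ h1
  refine ((differentiableOn_jacobian hd).inv fun z hz => hf.jacobian_ne_zero hz).mul ?_
  refine differentiableOn_det fun i j => ?_
  rcases eq_or_ne i l with rfl | h
  · simp only [Matrix.updateRow_self]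
    exact differentiableOn_const _
  · simp only [Matrix.updateRow_ne h]
    exact differentiableOn_jacobiMatrix hd i j

lemma LocallyBiholomorphicOn.differentiableOn_schwarzian
    (hf : LocallyBiholomorphicOn f (polydisk n)) (k i j : Fin n) :
    DifferentiableOn ℂ (schwarzian k i j f) (polydisk n) := by
  have hd := hf.differentiableOn
  have hJ := differentiableOn_jacobian hd
  have hlog : ∀ m, DifferentiableOn ℂ (fun z => pdLogJacobian m f z) (polydisk n) := fun m => by
    simp only [pdLogJacobian, div_eq_mul_inv]
    exact (differentiableOn_pd isOpen_polydisk hJ m).mul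
      (hJ.inv fun z hz => hf.jacobian_ne_zero hz)
  unfold schwarzian
  refine DifferentiableOn.sub ?_ ?_
  · refine DifferentiableOn.fun_sum fun l _ => ?_
    exact (differentiableOn_pd isOpen_polydisk (differentiableOn_pd isOpen_polydisk
      (differentiableOn_pi.1 hd l) j) i).mul (hf.differentiableOn_inv_jacobiMatrix k l)
  · exact (((hlog j).const_mul _).add ((hlog i).const_mul _)).const_mul _

lemma schwarzian_symm (hf : DifferentiableOn ℂ f (polydisk n)) (k i j : Fin n) {z : Fin n → ℂ}
    (hz : z ∈ polydisk n) : schwarzian k i j f z = schwarzian k j i f z := by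
  unfold schwarzian
  have : ∀ l, pd i (pd j fun w => f w l) z = pd j (pd i fun w => f w l) z := fun l =>
    pd_comm isOpen_polydisk (differentiableOn_pi.1 hf l) hz i j
  simp only [this]
  ring

end local_biholomorphic

/-! ### Bounds for the Schwarzian coefficients -/

section norm_bounds

variable {f : (Fin n → ℂ) → (Fin n → ℂ)} {α : ℝ}

lemma bergmanNorm_nonneg (z v : Fin n → ℂ) : 0 ≤ bergmanNorm z v := Real.sqrt_nonneg _

lemma bergmanNorm_sq (z v : Fin n → ℂ) :
    bergmanNorm z v ^ 2 = 2 * ∑ i, ‖v i‖ ^ 2 / (1 - ‖z i‖ ^ 2) ^ 2 := by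
  rw [bergmanNorm, Real.sq_sqrt]
  positivity

lemma bergmanNorm_smul (z v : Fin n → ℂ) {c : ℝ} (hc : 0 ≤ c) :
    bergmanNorm z (fun i => (c : ℂ) * v i) = c * bergmanNorm z v := by
  refine (sq_eq_sq₀ (bergmanNorm_nonneg _ _) (mul_nonneg hc (bergmanNorm_nonneg _ _))).1 ?_
  rw [mul_pow, bergmanNorm_sq, bergmanNorm_sq, Finset.mul_sum, Finset.mul_sum, Finset.mul_sum]
  refine Finset.sum_congr rfl fun i _ => ?_
  rw [norm_mul, Complex.norm_real, Real.norm_of_nonneg hc]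
  ring

lemma schwarzianOp_smul (z v : Fin n → ℂ) (c : ℂ) :
    schwarzianOp f z (fun i => c * v i) = fun k => c ^ 2 * schwarzianOp f z v k := by
  funext k
  simp only [schwarzianOp, Finset.mul_sum]
  refine Finset.sum_congr rfl fun i _ => Finset.sum_congr rfl fun j _ => ?_
  ring

/-- Homogeneity of degree two extends the bound from unit vectors; a vector of Bergman norm zero is
itself zero. -/
lemma bergmanNorm_schwarzianOp_le (hS : schwarzianNorm f ≤ (α : EReal)) {z : Fin n → ℂ}
    (hz : z ∈ polydisk n) (v : Fin n → ℂ) :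
    bergmanNorm z (schwarzianOp f z v) ≤ α * bergmanNorm z v ^ 2 := by
  have h1 : ∀ w, bergmanNorm z w = 1 → bergmanNorm z (schwarzianOp f z w) ≤ α := by
    intro w hw
    have h2 : (bergmanNorm z (schwarzianOp f z w) : EReal) ≤ schwarzianNormAt f z :=
      le_iSup₂_of_le (f := fun (v : Fin n → ℂ) (_ : v ∈ {v : Fin n → ℂ | bergmanNorm z v = 1}) =>
        (bergmanNorm z (schwarzianOp f z v) : EReal)) w hw le_rfl
    have h3 : schwarzianNormAt f z ≤ schwarzianNorm f :=
      le_iSup₂_of_le (f := fun (z : Fin n → ℂ) (_ : z ∈ polydisk n) => schwarzianNormAt f z)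
        z hz le_rfl
    exact EReal.coe_le_coe_iff.1 ((h2.trans h3).trans hS)
  rcases eq_or_ne (bergmanNorm z v) 0 with h0 | h0
  · have hv : v = 0 := by
      have := bergmanNorm_sq z v
      rw [h0] at this
      have h2 : ∑ i, ‖v i‖ ^ 2 / (1 - ‖z i‖ ^ 2) ^ 2 = 0 := by linarith
      rw [Finset.sum_eq_zero_iff_of_nonneg (fun i _ => by positivity)] at h2
      funext i
      have h3 := h2 i (Finset.mem_univ i)
      have h4 := weight_pos hz i
      rw [div_eq_zero_iff] at h3
      rcases h3 with h3 | h3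
      · simpa using h3
      · exact absurd h3 (by positivity)
    have h2 : schwarzianOp f z v = 0 := by
      funext k; simp [schwarzianOp, hv]
    rw [h0, h2]
    simp [bergmanNorm]
  · set N := bergmanNorm z v with hN
    have hN0 : 0 < N := lt_of_le_of_ne (bergmanNorm_nonneg _ _) (Ne.symm h0)
    have h2 := h1 (fun i => ((N⁻¹ : ℝ) : ℂ) * v i) (by
      rw [bergmanNorm_smul _ _ (by positivity), ← hN, inv_mul_cancel₀ h0])
    rw [schwarzianOp_smul] at h2
    have h3 := bergmanNorm_smul z (schwarzianOp f z v) (c := N⁻¹ ^ 2) (by positivity)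
    push_cast at h2 h3
    rw [h3, inv_pow, inv_mul_le_iff₀ (by positivity)] at h2
    linarith

/-- Keeping only the `k`-th term of the Bergman norm produces the factor `1 - |z_k|²` that later
forces vanishing. -/
lemma norm_schwarzianOp_le (hS : schwarzianNorm f ≤ (α : EReal)) {z : Fin n → ℂ}
    (hz : z ∈ polydisk n) (v : Fin n → ℂ) (k : Fin n) :
    ‖schwarzianOp f z v k‖ ≤ Real.sqrt 2 * α * (1 - ‖z k‖ ^ 2) *
      ∑ i, ‖v i‖ ^ 2 / (1 - ‖z i‖ ^ 2) ^ 2 := by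
  have h1 := bergmanNorm_schwarzianOp_le hS hz v
  have hw := weight_pos hz k
  have h2 : Real.sqrt 2 * (‖schwarzianOp f z v k‖ / (1 - ‖z k‖ ^ 2)) ≤
      bergmanNorm z (schwarzianOp f z v) := by
    refine Real.le_sqrt_of_sq_le ?_
    rw [mul_pow, Real.sq_sqrt zero_le_two, div_pow]
    gcongr
    exact Finset.single_le_sum (f := fun i => ‖schwarzianOp f z v i‖ ^ 2 / (1 - ‖z i‖ ^ 2) ^ 2)
      (fun i _ => by positivity) (Finset.mem_univ k)
  rw [bergmanNorm_sq] at h1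
  have h3 := h2.trans h1
  set W := ∑ i, ‖v i‖ ^ 2 / (1 - ‖z i‖ ^ 2) ^ 2
  have hs : 0 < Real.sqrt 2 := by positivity
  have hs2 : Real.sqrt 2 * Real.sqrt 2 = 2 := Real.mul_self_sqrt zero_le_two
  have h4 : Real.sqrt 2 * (‖schwarzianOp f z v k‖ / (1 - ‖z k‖ ^ 2)) ≤
      Real.sqrt 2 * (Real.sqrt 2 * α * W) := by
    refine h3.trans (le_of_eq ?_)
    linear_combination (-α * W) * hs2
  have h5 := le_of_mul_le_mul_left h4 hs
  rw [div_le_iff₀ hw] at h5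
  linarith

lemma alpha_nonneg (hS : schwarzianNorm f ≤ (α : EReal)) (hn : 0 < n) : 0 ≤ α := by
  have h0 : (0 : Fin n → ℂ) ∈ polydisk n := fun i => by simp
  have h1 := bergmanNorm_schwarzianOp_le hS h0 (Pi.single ⟨0, hn⟩ 1)
  have h2 := (bergmanNorm_nonneg _ _).trans h1
  rw [bergmanNorm_sq] at h2
  have h3 : 0 < ∑ i : Fin n, ‖(Pi.single ⟨0, hn⟩ 1 : Fin n → ℂ) i‖ ^ 2 /
      (1 - ‖(0 : Fin n → ℂ) i‖ ^ 2) ^ 2 := by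
    refine Finset.sum_pos' (fun i _ => by positivity) ⟨⟨0, hn⟩, Finset.mem_univ _, by simp⟩
  by_contra hneg
  nlinarith [mul_pos (not_le.1 hneg |> neg_pos.2) h3]

lemma schwarzianOp_single (z : Fin n → ℂ) (i k : Fin n) (x : ℂ) :
    schwarzianOp f z (Pi.single i x) k = x ^ 2 * schwarzian k i i f z := by
  unfold schwarzianOp
  rw [Finset.sum_eq_single i, Finset.sum_eq_single i]
  · simp; ring
  · intro b _ hb; simp [hb]
  · simp
  · intro b _ hb; simp [hb]
  · simp

lemma schwarzianOp_polarization (hf : DifferentiableOn ℂ f (polydisk n)) {z : Fin n → ℂ}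
    (hz : z ∈ polydisk n) (i j k : Fin n) (x y : ℂ) :
    schwarzianOp f z (Pi.single i x + Pi.single j y) k -
      schwarzianOp f z (Pi.single i x + Pi.single j (-y)) k =
      4 * x * y * schwarzian k i j f z := by
  have hbil : ∀ (a b : Fin n) (u v : ℂ), ∑ p, ∑ q, (Pi.single a u : Fin n → ℂ) p *
      schwarzian k p q f z * (Pi.single b v : Fin n → ℂ) q = u * v * schwarzian k a b f z := by
    intro a b u v
    rw [Finset.sum_eq_single a, Finset.sum_eq_single b]
    · simp; ring
    · intro b _ hb; simp [hb]
    · simp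
    · intro b _ hb; simp [hb]
    · simp
  unfold schwarzianOp
  simp only [Pi.add_apply, add_mul, mul_add, Finset.sum_add_distrib, hbil]
  rw [schwarzian_symm hf k j i hz]
  ring

lemma sum_single_add_single {i j : Fin n} (hij : i ≠ j) (x y : ℂ) (w : Fin n → ℝ) :
    ∑ m, ‖(Pi.single i x + Pi.single j y : Fin n → ℂ) m‖ ^ 2 / w m =
      ‖x‖ ^ 2 / w i + ‖y‖ ^ 2 / w j := by
  rw [Finset.sum_eq_add i j hij]
  · simp [hij, hij.symm]
  · intro c _ hc
    simp [hc.1, hc.2]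
  · simp
  · simp

lemma norm_schwarzian_diag_le (hS : schwarzianNorm f ≤ (α : EReal)) {z : Fin n → ℂ}
    (hz : z ∈ polydisk n) (k i : Fin n) :
    ‖schwarzian k i i f z‖ ≤ Real.sqrt 2 * α * (1 - ‖z k‖ ^ 2) / (1 - ‖z i‖ ^ 2) ^ 2 := by
  have h1 := norm_schwarzianOp_le hS hz (Pi.single i 1) k
  rw [schwarzianOp_single, one_pow, one_mul] at h1
  refine h1.trans (le_of_eq ?_)
  rw [Finset.sum_eq_single i]
  · simp [div_eq_mul_inv]
  · intro b _ hb; simp [hb]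
  · simp

lemma norm_schwarzian_offDiag_le (hf : DifferentiableOn ℂ f (polydisk n))
    (hS : schwarzianNorm f ≤ (α : EReal)) {z : Fin n → ℂ}
    (hz : z ∈ polydisk n) (k : Fin n) {i j : Fin n} (hij : i ≠ j) :
    ‖schwarzian k i j f z‖ ≤ Real.sqrt 2 * α * (1 - ‖z k‖ ^ 2) /
      ((1 - ‖z i‖ ^ 2) * (1 - ‖z j‖ ^ 2)) := by
  set p := 1 - ‖z i‖ ^ 2 with hp
  set q := 1 - ‖z j‖ ^ 2 with hq
  have hp0 : 0 < p := weight_pos hz i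
  have hq0 : 0 < q := weight_pos hz j
  -- Polarization with entries equal to the weights, so that both test vectors have weighted sum
  -- exactly `2`.
  have h1 := norm_schwarzianOp_le hS hz (Pi.single i (p : ℂ) + Pi.single j (q : ℂ)) k
  have h2 := norm_schwarzianOp_le hS hz (Pi.single i (p : ℂ) + Pi.single j (-q : ℂ)) k
  rw [sum_single_add_single hij, ← hp, ← hq] at h1 h2
  have h3 := norm_sub_le (schwarzianOp f z (Pi.single i (p : ℂ) + Pi.single j (q : ℂ)) k)
    (schwarzianOp f z (Pi.single i (p : ℂ) + Pi.single j (-q : ℂ)) k)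
  rw [schwarzianOp_polarization hf hz] at h3
  simp only [norm_mul, norm_neg, Complex.norm_real, Real.norm_of_nonneg hp0.le,
    Real.norm_of_nonneg hq0.le, div_self (pow_ne_zero 2 hp0.ne'),
    div_self (pow_ne_zero 2 hq0.ne')] at h1 h2 h3
  norm_num at h3
  rw [le_div_iff₀ (by positivity)]
  nlinarith

/-- As a function of `z_k` alone the coefficient is holomorphic and is bounded by a constant times
`1 - |z_k|²`: the other weights do not involve `z_k`. -/
lemma schwarzian_eq_zero (hf : LocallyBiholomorphicOn f (polydisk n))
    (hS : schwarzianNorm f ≤ (α : EReal)) {z : Fin n → ℂ}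
    (hz : z ∈ polydisk n) {k i j : Fin n} (hi : i ≠ k) (hj : j ≠ k) :
    schwarzian k i j f z = 0 := by
  have hd := hf.differentiableOn
  have hbound : ∃ C : ℝ, ∀ t ∈ ball (0 : ℂ) 1,
      ‖schwarzian k i j f (Function.update z k t)‖ ≤ C * (1 - ‖t‖ ^ 2) := by
    rcases eq_or_ne i j with rfl | hij
    · refine ⟨Real.sqrt 2 * α / (1 - ‖z i‖ ^ 2) ^ 2, fun t ht => ?_⟩
      have := norm_schwarzian_diag_le hS (update_mem_polydisk hz k ht) k i
      rw [Function.update_self, Function.update_of_ne hi] at this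
      refine this.trans (le_of_eq ?_)
      ring
    · refine ⟨Real.sqrt 2 * α / ((1 - ‖z i‖ ^ 2) * (1 - ‖z j‖ ^ 2)), fun t ht => ?_⟩
      have := norm_schwarzian_offDiag_le hd hS (update_mem_polydisk hz k ht) k hij
      rw [Function.update_self, Function.update_of_ne hi, Function.update_of_ne hj] at this
      refine this.trans (le_of_eq ?_)
      ring
  obtain ⟨C, hC⟩ := hbound
  have h1 : DifferentiableOn ℂ (fun t => schwarzian k i j f (Function.update z k t)) (ball 0 1) :=
    fun t ht => (hasDerivAt_pd ((hf.differentiableOn_schwarzian k i j).differentiableAt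
      (isOpen_polydisk.mem_nhds
        (update_mem_polydisk hz k ht)))).differentiableAt.differentiableWithinAt
  have h2 := eq_zero_of_norm_le_one_sub_sq h1 hC (t := z k) (by simpa using hz k)
  simpa using h2

lemma norm_schwarzian_self_le (hS : schwarzianNorm f ≤ (α : EReal)) {z : Fin n → ℂ}
    (hz : z ∈ polydisk n) (k : Fin n) :
    ‖schwarzian k k k f z‖ ≤ Real.sqrt 2 * α / (1 - ‖z k‖ ^ 2) := by
  refine (norm_schwarzian_diag_le hS hz k k).trans (le_of_eq ?_)
  have := weight_pos hz k
  field_simp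

lemma norm_schwarzian_mixed_le (hf : DifferentiableOn ℂ f (polydisk n))
    (hS : schwarzianNorm f ≤ (α : EReal)) {z : Fin n → ℂ}
    (hz : z ∈ polydisk n) {i j : Fin n} (hij : i ≠ j) :
    ‖schwarzian i i j f z‖ ≤ Real.sqrt 2 * α / (1 - ‖z j‖ ^ 2) := by
  refine (norm_schwarzian_offDiag_le hf hS hz i hij).trans (le_of_eq ?_)
  have := weight_pos hz i
  field_simp

end norm_bounds

/-! ### The frame of partial derivatives and its connection coefficients -/

/-- The coordinate functionals of the frame `∂f/∂z_1, …, ∂f/∂z_n` at `z`. -/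
def coeff (f : (Fin n → ℂ) → (Fin n → ℂ)) (z : Fin n → ℂ) (m : Fin n) :
    (Fin n → ℂ) →L[ℂ] ℂ :=
  (ContinuousLinearMap.proj m : (Fin n → ℂ) →L[ℂ] ℂ).comp
    (LinearMap.toContinuousLinearMap (Matrix.mulVecLin (jacobiMatrix f z)⁻¹))

lemma coeff_apply (f : (Fin n → ℂ) → (Fin n → ℂ)) (z : Fin n → ℂ) (m : Fin n) (v : Fin n → ℂ) :
    coeff f z m v = ∑ l, (jacobiMatrix f z)⁻¹ m l * v l := rfl

/-- The connection coefficient `Γ^i_{ij}` of the flat connection pulled back by `f`. -/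
def conn (f : (Fin n → ℂ) → (Fin n → ℂ)) (i j : Fin n) (z : Fin n → ℂ) : ℂ :=
  coeff f z i (dirDeriv i (dirDeriv j f) z)

section frame

variable {f : (Fin n → ℂ) → (Fin n → ℂ)} {α : ℝ}

lemma jacobiMatrix_apply (hf : LocallyBiholomorphicOn f (polydisk n)) {z : Fin n → ℂ}
    (hz : z ∈ polydisk n) (l i : Fin n) : jacobiMatrix f z l i = dirDeriv i f z l :=
  pd_apply_eq_dirDeriv (hf.differentiableOn.differentiableAt (isOpen_polydisk.mem_nhds hz)) i l

lemma isUnit_det (hf : LocallyBiholomorphicOn f (polydisk n)) {z : Fin n → ℂ}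
    (hz : z ∈ polydisk n) : IsUnit (jacobiMatrix f z).det :=
  isUnit_iff_ne_zero.2 (hf.jacobian_ne_zero hz)

lemma coeff_frame (hf : LocallyBiholomorphicOn f (polydisk n)) {z : Fin n → ℂ}
    (hz : z ∈ polydisk n) (m i : Fin n) :
    coeff f z m (dirDeriv i f z) = if m = i then 1 else 0 := by
  have h := congrFun (congrFun (Matrix.nonsing_inv_mul _ (isUnit_det hf hz)) m) i
  rw [Matrix.mul_apply, Matrix.one_apply] at h
  rw [coeff_apply, ← h]
  exact Finset.sum_congr rfl fun l _ => by rw [jacobiMatrix_apply hf hz]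

lemma coeff_frame_self (hf : LocallyBiholomorphicOn f (polydisk n)) {z : Fin n → ℂ}
    (hz : z ∈ polydisk n) (m : Fin n) : coeff f z m (dirDeriv m f z) = 1 := by
  rw [coeff_frame hf hz, if_pos rfl]

lemma coeff_frame_of_ne (hf : LocallyBiholomorphicOn f (polydisk n)) {z : Fin n → ℂ}
    (hz : z ∈ polydisk n) {m i : Fin n} (h : m ≠ i) : coeff f z m (dirDeriv i f z) = 0 := by
  rw [coeff_frame hf hz, if_neg h]

lemma sum_coeff_smul_frame (hf : LocallyBiholomorphicOn f (polydisk n)) {z : Fin n → ℂ}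
    (hz : z ∈ polydisk n) (v : Fin n → ℂ) : ∑ m, coeff f z m v • dirDeriv m f z = v := by
  have h : (jacobiMatrix f z).mulVec ((jacobiMatrix f z)⁻¹.mulVec v) = v := by
    rw [Matrix.mulVec_mulVec, Matrix.mul_nonsing_inv _ (isUnit_det hf hz), Matrix.one_mulVec]
  conv_rhs => rw [← h]
  funext l
  rw [Finset.sum_apply, Matrix.mulVec, dotProduct]
  refine Finset.sum_congr rfl fun m _ => ?_
  rw [Pi.smul_apply, jacobiMatrix_apply hf hz, smul_eq_mul, mul_comm]
  rfl

lemma frame_ext (hf : LocallyBiholomorphicOn f (polydisk n)) {z : Fin n → ℂ}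
    (hz : z ∈ polydisk n) {v w : Fin n → ℂ} (h : ∀ m, coeff f z m v = coeff f z m w) : v = w := by
  rw [← sum_coeff_smul_frame hf hz v, ← sum_coeff_smul_frame hf hz w]
  simp only [h]

/-- The frame coordinates of the Hessian are the connection coefficients `Γ^k_ij`; the Schwarzian is
`Γ^k_ij` minus its trace part. -/
lemma coeff_hess (hf : LocallyBiholomorphicOn f (polydisk n)) {z : Fin n → ℂ}
    (hz : z ∈ polydisk n) (k i j : Fin n) :
    coeff f z k (dirDeriv i (dirDeriv j f) z) = schwarzian k i j f z +
      1 / ((n : ℂ) + 1) * ((if k = i then 1 else 0) * pdLogJacobian j f z +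
        (if k = j then 1 else 0) * pdLogJacobian i f z) := by
  have hd := hf.differentiableOn
  have : ∀ l, pd i (pd j fun w => f w l) z = dirDeriv i (dirDeriv j f) z l := by
    intro l
    rw [← pd_apply_eq_dirDeriv ((differentiableOn_dirDeriv isOpen_polydisk hd j).differentiableAt
      (isOpen_polydisk.mem_nhds hz))]
    refine pd_congr ?_ i
    filter_upwards [isOpen_polydisk.mem_nhds hz] with y hy
    exact pd_apply_eq_dirDeriv (hd.differentiableAt (isOpen_polydisk.mem_nhds hy)) j l
  simp only [schwarzian, this, coeff_apply]
  rw [sub_add_cancel]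
  exact Finset.sum_congr rfl fun l _ => mul_comm _ _

lemma coeff_hess_eq_zero (hf : LocallyBiholomorphicOn f (polydisk n))
    (hS : schwarzianNorm f ≤ (α : EReal)) {z : Fin n → ℂ}
    (hz : z ∈ polydisk n) {k i j : Fin n} (hi : k ≠ i) (hj : k ≠ j) :
    coeff f z k (dirDeriv i (dirDeriv j f) z) = 0 := by
  rw [coeff_hess hf hz, schwarzian_eq_zero hf hS hz hi.symm hj.symm, if_neg hi, if_neg hj]
  ring

lemma hess_comm (hf : LocallyBiholomorphicOn f (polydisk n)) {z : Fin n → ℂ}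
    (hz : z ∈ polydisk n) (i j : Fin n) :
    dirDeriv i (dirDeriv j f) z = dirDeriv j (dirDeriv i f) z :=
  dirDeriv_comm isOpen_polydisk hf.differentiableOn hz i j

lemma coeff_hess_left (f : (Fin n → ℂ) → (Fin n → ℂ)) (z : Fin n → ℂ) (k j : Fin n) :
    coeff f z k (dirDeriv k (dirDeriv j f) z) = conn f k j z := rfl

lemma coeff_hess_right (hf : LocallyBiholomorphicOn f (polydisk n)) {z : Fin n → ℂ}
    (hz : z ∈ polydisk n) (k j : Fin n) :
    coeff f z k (dirDeriv j (dirDeriv k f) z) = conn f k j z := by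
  rw [hess_comm hf hz, conn]

/-- Geometrically, the coordinate vector keeps its direction along its own disk; this is the
infinitesimal form of `line_eq`. -/
lemma hess_self (hf : LocallyBiholomorphicOn f (polydisk n))
    (hS : schwarzianNorm f ≤ (α : EReal)) {z : Fin n → ℂ} (hz : z ∈ polydisk n) (k : Fin n) :
    dirDeriv k (dirDeriv k f) z = conn f k k z • dirDeriv k f z := by
  refine frame_ext hf hz fun m => ?_
  rw [map_smul, smul_eq_mul]
  rcases eq_or_ne m k with rfl | h
  · rw [coeff_frame_self hf hz, mul_one, conn]
  · rw [coeff_frame_of_ne hf hz h, mul_zero, coeff_hess_eq_zero hf hS hz h h]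

lemma hess_mixed (hf : LocallyBiholomorphicOn f (polydisk n))
    (hS : schwarzianNorm f ≤ (α : EReal)) {z : Fin n → ℂ} (hz : z ∈ polydisk n) {i j : Fin n}
    (hij : i ≠ j) : dirDeriv i (dirDeriv j f) z =
      conn f i j z • dirDeriv i f z + conn f j i z • dirDeriv j f z := by
  refine frame_ext hf hz fun m => ?_
  rw [map_add, map_smul, map_smul, smul_eq_mul, smul_eq_mul]
  rcases eq_or_ne m i with rfl | hi
  · rw [coeff_frame_self hf hz, coeff_frame_of_ne hf hz hij, coeff_hess_left]
    ring
  rcases eq_or_ne m j with rfl | hj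
  · rw [coeff_frame_self hf hz, coeff_frame_of_ne hf hz hi, coeff_hess_right hf hz]
    ring
  · rw [coeff_frame_of_ne hf hz hi, coeff_frame_of_ne hf hz hj, coeff_hess_eq_zero hf hS hz hi hj]
    ring

lemma schwarzian_eq_conn_of_ne (hf : LocallyBiholomorphicOn f (polydisk n)) {z : Fin n → ℂ}
    (hz : z ∈ polydisk n) {i j : Fin n} (hij : i ≠ j) :
    schwarzian i i j f z = conn f i j z - pdLogJacobian j f z / ((n : ℂ) + 1) := by
  have h := coeff_hess hf hz i i j
  rw [coeff_hess_left, if_pos rfl, if_neg hij] at h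
  rw [h]; ring

lemma schwarzian_eq_conn_self (hf : LocallyBiholomorphicOn f (polydisk n)) {z : Fin n → ℂ}
    (hz : z ∈ polydisk n) (i : Fin n) :
    schwarzian i i i f z = conn f i i z - 2 * (pdLogJacobian i f z / ((n : ℂ) + 1)) := by
  have h := coeff_hess hf hz i i i
  rw [coeff_hess_left, if_pos rfl] at h
  rw [h]; ring

/-- The `log J` terms cancel in `S^k_kk - 2 S^s_sk`, so this combination of connection coefficients
is controlled although the individual ones are not. The same holds for the difference in
`norm_conn_sub_conn_le`. -/
lemma norm_conn_self_sub_le (hf : LocallyBiholomorphicOn f (polydisk n))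
    (hS : schwarzianNorm f ≤ (α : EReal)) {z : Fin n → ℂ} (hz : z ∈ polydisk n) {k s : Fin n}
    (h : s ≠ k) : ‖conn f k k z - 2 * conn f s k z‖ ≤
      3 * (Real.sqrt 2 * α) / (1 - ‖z k‖ ^ 2) := by
  have h1 := norm_schwarzian_self_le hS hz k
  have h2 := norm_schwarzian_mixed_le hf.differentiableOn hS hz h
  have h3 : conn f k k z - 2 * conn f s k z = schwarzian k k k f z - 2 * schwarzian s s k f z := by
    rw [schwarzian_eq_conn_self hf hz, schwarzian_eq_conn_of_ne hf hz h]; ring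
  rw [h3]
  refine (norm_sub_le _ _).trans ?_
  rw [norm_mul, Complex.norm_two]
  calc _ ≤ Real.sqrt 2 * α / (1 - ‖z k‖ ^ 2) + 2 * (Real.sqrt 2 * α / (1 - ‖z k‖ ^ 2)) := by
        gcongr
    _ = _ := by ring

lemma norm_conn_sub_conn_le (hf : LocallyBiholomorphicOn f (polydisk n))
    (hS : schwarzianNorm f ≤ (α : EReal)) {z : Fin n → ℂ} (hz : z ∈ polydisk n) {k s j : Fin n}
    (h : s ≠ k) (hj : j ≠ k) : ‖conn f j k z - conn f s k z‖ ≤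
      2 * (Real.sqrt 2 * α) / (1 - ‖z k‖ ^ 2) := by
  have h1 := norm_schwarzian_mixed_le hf.differentiableOn hS hz hj
  have h2 := norm_schwarzian_mixed_le hf.differentiableOn hS hz h
  have h3 : conn f j k z - conn f s k z = schwarzian j j k f z - schwarzian s s k f z := by
    rw [schwarzian_eq_conn_of_ne hf hz h, schwarzian_eq_conn_of_ne hf hz hj]; ring
  rw [h3]
  refine (norm_sub_le _ _).trans ?_
  calc _ ≤ Real.sqrt 2 * α / (1 - ‖z k‖ ^ 2) + Real.sqrt 2 * α / (1 - ‖z k‖ ^ 2) := by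
        gcongr
    _ = _ := by ring

lemma differentiableOn_coeff (hf : LocallyBiholomorphicOn f (polydisk n))
    {F : (Fin n → ℂ) → (Fin n → ℂ)} {U : Set (Fin n → ℂ)} (hU : U ⊆ polydisk n)
    (hF : DifferentiableOn ℂ F U) (m : Fin n) :
    DifferentiableOn ℂ (fun z => coeff f z m (F z)) U := by
  simp only [coeff_apply]
  refine DifferentiableOn.fun_sum fun l _ => ?_
  exact ((hf.differentiableOn_inv_jacobiMatrix m l).mono hU).mul (differentiableOn_pi.1 hF l)

lemma differentiableOn_frame (hf : LocallyBiholomorphicOn f (polydisk n)) (i : Fin n) :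
    DifferentiableOn ℂ (dirDeriv i f) (polydisk n) :=
  differentiableOn_dirDeriv isOpen_polydisk hf.differentiableOn i

lemma differentiableOn_conn (hf : LocallyBiholomorphicOn f (polydisk n)) (i j : Fin n) :
    DifferentiableOn ℂ (conn f i j) (polydisk n) :=
  differentiableOn_coeff hf subset_rfl
    (differentiableOn_dirDeriv isOpen_polydisk (differentiableOn_frame hf j) i) i

lemma third_comm (hf : LocallyBiholomorphicOn f (polydisk n)) {z : Fin n → ℂ}
    (hz : z ∈ polydisk n) (i j k : Fin n) :
    dirDeriv i (dirDeriv j (dirDeriv k f)) z = dirDeriv k (dirDeriv i (dirDeriv j f)) z := by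
  have h1 : dirDeriv j (dirDeriv k f) =ᶠ[𝓝 z] dirDeriv k (dirDeriv j f) := by
    filter_upwards [isOpen_polydisk.mem_nhds hz] with y hy using hess_comm hf hy j k
  rw [dirDeriv_congr h1 i]
  exact dirDeriv_comm isOpen_polydisk (differentiableOn_frame hf j) hz i k

lemma dirDeriv_hess_mixed (hf : LocallyBiholomorphicOn f (polydisk n))
    (hS : schwarzianNorm f ≤ (α : EReal)) {z : Fin n → ℂ} (hz : z ∈ polydisk n) {i j : Fin n}
    (hij : i ≠ j) (m : Fin n) : dirDeriv m (dirDeriv i (dirDeriv j f)) z =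
      (pd m (conn f i j) z • dirDeriv i f z + conn f i j z • dirDeriv m (dirDeriv i f) z) +
      (pd m (conn f j i) z • dirDeriv j f z + conn f j i z • dirDeriv m (dirDeriv j f) z) := by
  have hn := isOpen_polydisk.mem_nhds hz
  have h1 : dirDeriv i (dirDeriv j f) =ᶠ[𝓝 z] fun w =>
      conn f i j w • dirDeriv i f w + conn f j i w • dirDeriv j f w := by
    filter_upwards [hn] with y hy using hess_mixed hf hS hy hij
  have hc : ∀ a b, DifferentiableAt ℂ (conn f a b) z := fun a b =>
    (differentiableOn_conn hf a b).differentiableAt hn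
  have hF : ∀ a, DifferentiableAt ℂ (dirDeriv a f) z := fun a =>
    (differentiableOn_frame hf a).differentiableAt hn
  rw [dirDeriv_congr h1 m, dirDeriv_add ((hc i j).fun_smul (hF i)) ((hc j i).fun_smul (hF j)),
    dirDeriv_smul (hc i j) (hF i), dirDeriv_smul (hc j i) (hF j)]

/-- The `s`-th frame coordinate of the symmetry of third derivatives, a flatness equation for the
connection; `pd_conn_self` is the case of a repeated index. -/
lemma pd_conn_of_distinct (hf : LocallyBiholomorphicOn f (polydisk n))
    (hS : schwarzianNorm f ≤ (α : EReal)) {z : Fin n → ℂ} (hz : z ∈ polydisk n) {j k s : Fin n}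
    (hjk : j ≠ k) (hjs : j ≠ s) (hks : k ≠ s) :
    pd j (conn f s k) z = conn f k j z * conn f s k z + conn f j k z * conn f s j z -
      conn f s k z * conn f s j z := by
  have h := congrArg (coeff f z s) (third_comm hf hz j k s)
  rw [dirDeriv_hess_mixed hf hS hz hks j, dirDeriv_hess_mixed hf hS hz hjk s] at h
  simp only [map_add, map_smul, smul_eq_mul, coeff_frame_self hf hz,
    coeff_frame_of_ne hf hz hks.symm, coeff_frame_of_ne hf hz hjs.symm,
    coeff_hess_eq_zero hf hS hz hjs.symm hks.symm, coeff_hess_left, coeff_hess_right hf hz] at h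
  linear_combination h

lemma pd_conn_self (hf : LocallyBiholomorphicOn f (polydisk n))
    (hS : schwarzianNorm f ≤ (α : EReal)) {z : Fin n → ℂ} (hz : z ∈ polydisk n) {k s : Fin n}
    (hks : k ≠ s) :
    pd k (conn f s s) z = pd s (conn f s k) z + conn f k s z * conn f s k z := by
  have hn := isOpen_polydisk.mem_nhds hz
  have h1 : dirDeriv s (dirDeriv s f) =ᶠ[𝓝 z] fun w => conn f s s w • dirDeriv s f w := by
    filter_upwards [hn] with y hy using hess_self hf hS hy s
  have h := congrArg (coeff f z s) (third_comm hf hz k s s)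
  rw [dirDeriv_congr h1, dirDeriv_smul ((differentiableOn_conn hf s s).differentiableAt hn)
    ((differentiableOn_frame hf s).differentiableAt hn), dirDeriv_hess_mixed hf hS hz hks s] at h
  simp only [map_add, map_smul, smul_eq_mul, coeff_frame_self hf hz,
    coeff_frame_of_ne hf hz hks.symm, coeff_hess_left, coeff_hess_right hf hz] at h
  linear_combination h

/-- The second order invariant `∂_k Γ^s_{ss} - 2 ∂_s Γ^s_{sk}` is expressed by the Schwarzian
derivatives. -/
lemma norm_pd_conn_sub_le (hf : LocallyBiholomorphicOn f (polydisk n))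
    (hS : schwarzianNorm f ≤ (α : EReal)) {z : Fin n → ℂ} (hz : z ∈ polydisk n) {k s : Fin n}
    (hks : k ≠ s) (hzk : z k = 0) (hzs : z s = 0) :
    ‖conn f k s z * conn f s k z - pd s (conn f s k) z‖ ≤ 3 * (Real.sqrt 2 * α) := by
  have hn := isOpen_polydisk.mem_nhds hz
  have hd := hf.differentiableOn
  have hJ := differentiableOn_jacobian hd
  have hJ0 := hf.jacobian_ne_zero hz
  have hb : ∀ m, DifferentiableOn ℂ (fun w => pdLogJacobian m f w / ((n : ℂ) + 1))
      (polydisk n) := fun m => by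
    simp only [pdLogJacobian, div_eq_mul_inv]
    exact ((differentiableOn_pd isOpen_polydisk hJ m).mul
      (hJ.inv fun z hz => hf.jacobian_ne_zero hz)).mul_const _
  have hlog : ∀ i j, pd i (fun w => pdLogJacobian j f w / ((n : ℂ) + 1)) z =
      (pd i (pd j (jacobian f)) z * jacobian f z - pd j (jacobian f) z * pd i (jacobian f) z) /
        jacobian f z ^ 2 / ((n : ℂ) + 1) := by
    intro i j
    have h1 := pd_div ((differentiableOn_pd isOpen_polydisk hJ j).differentiableAt hn)
      (hJ.differentiableAt hn) hJ0 i
    have h2 : DifferentiableAt ℂ (fun w => pd j (jacobian f) w / jacobian f w) z := by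
      simp only [div_eq_mul_inv]
      exact ((differentiableOn_pd isOpen_polydisk hJ j).differentiableAt hn).fun_mul
        ((hJ.differentiableAt hn).fun_inv hJ0)
    have h3 := pd_const_mul (((n : ℂ) + 1)⁻¹) h2 i
    rw [h1] at h3
    rw [div_eq_mul_inv _ ((n : ℂ) + 1), mul_comm, ← h3]
    refine congrArg (fun g : (Fin n → ℂ) → ℂ => pd i g z) ?_
    funext w
    rw [pdLogJacobian, div_eq_mul_inv _ ((n : ℂ) + 1), mul_comm]
  have hsymm := pd_comm isOpen_polydisk hJ hz k s
  have hA : pd k (schwarzian s s s f) z = pd k (conn f s s) z -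
      2 * pd k (fun w => pdLogJacobian s f w / ((n : ℂ) + 1)) z := by
    have h1 : schwarzian s s s f =ᶠ[𝓝 z] fun w => conn f s s w -
        2 * (pdLogJacobian s f w / ((n : ℂ) + 1)) := by
      filter_upwards [hn] with y hy using schwarzian_eq_conn_self hf hy s
    rw [pd_congr h1, pd_sub ((differentiableOn_conn hf s s).differentiableAt hn)
      (((hb s).differentiableAt hn).const_mul 2), pd_const_mul 2 ((hb s).differentiableAt hn)]
  have hB : pd s (schwarzian s s k f) z = pd s (conn f s k) z -
      pd s (fun w => pdLogJacobian k f w / ((n : ℂ) + 1)) z := by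
    have h1 : schwarzian s s k f =ᶠ[𝓝 z] fun w => conn f s k w -
        pdLogJacobian k f w / ((n : ℂ) + 1) := by
      filter_upwards [hn] with y hy using schwarzian_eq_conn_of_ne hf hy hks.symm
    rw [pd_congr h1, pd_sub ((differentiableOn_conn hf s k).differentiableAt hn)
      ((hb k).differentiableAt hn)]
  -- The second derivatives of `log J` cancel by symmetry, and `pd_conn_self` eliminates `∂_k
  -- Γ^s_ss`.
  have hX : conn f k s z * conn f s k z - pd s (conn f s k) z =
      pd k (schwarzian s s s f) z - 2 * pd s (schwarzian s s k f) z := by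
    rw [hA, hB, hlog, hlog, hsymm, pd_conn_self hf hS hz hks]
    ring
  rw [hX]
  -- Each derivative is taken in a variable absent from the bound of its coefficient, and the
  -- variable in that bound is zero; Cauchy's estimate therefore gives exactly `√2 α`.
  have h1 : ‖pd k (schwarzian s s s f) z‖ ≤ Real.sqrt 2 * α := by
    refine norm_pd_le isOpen_polydisk (hf.differentiableOn_schwarzian s s s) hzk
      (fun t ht => update_mem_polydisk hz k ht) fun t ht => ?_
    have := norm_schwarzian_self_le hS (update_mem_polydisk hz k ht) s
    rw [Function.update_of_ne hks.symm, hzs] at this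
    simpa using this
  have h2 : ‖pd s (schwarzian s s k f) z‖ ≤ Real.sqrt 2 * α := by
    refine norm_pd_le isOpen_polydisk (hf.differentiableOn_schwarzian s s k) hzs
      (fun t ht => update_mem_polydisk hz s ht) fun t ht => ?_
    have := norm_schwarzian_mixed_le hd hS (update_mem_polydisk hz s ht) hks.symm
    rw [Function.update_of_ne hks, hzk] at this
    simpa using this
  refine (norm_sub_le _ _).trans ?_
  rw [norm_mul, Complex.norm_two]
  linarith

end frame

/-! ### Coordinate disks and the lines containing their images -/

/-- The coordinate of `f` along the line that contains the image of the `k`-th coordinate disk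
through `z`, with origin `f z`, as the `k`-th coordinate takes the value `t`. -/
def lineCoord (f : (Fin n → ℂ) → (Fin n → ℂ)) (k : Fin n) (t : ℂ) (z : Fin n → ℂ) : ℂ :=
  coeff f z k (f (Function.update z k t) - f z)

/-- The derivative of `lineCoord` in `t`. -/
def lineSpeed (f : (Fin n → ℂ) → (Fin n → ℂ)) (k : Fin n) (t : ℂ) (z : Fin n → ℂ) : ℂ :=
  coeff f z k (dirDeriv k f (Function.update z k t))

/-- The factor by which the `s`-th frame vector is stretched along the `k`-th coordinate disk. -/
def lineFactor (f : (Fin n → ℂ) → (Fin n → ℂ)) (s k : Fin n) (t : ℂ) (z : Fin n → ℂ) : ℂ :=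
  1 + lineCoord f k t z * conn f s k z

/-- The projective coordinate on the line containing the image of the `k`-th coordinate disk
that is normalized by the `s`-th direction. -/
def normCoord (f : (Fin n → ℂ) → (Fin n → ℂ)) (s k : Fin n) (t : ℂ) (z : Fin n → ℂ) : ℂ :=
  lineCoord f k t z / lineFactor f s k t z

lemma differentiable_update (k : Fin n) (t : ℂ) :
    Differentiable ℂ (fun w : Fin n → ℂ => Function.update w k t) := by
  rw [differentiable_pi]
  intro i
  rcases eq_or_ne i k with rfl | h
  · simp
  · simp only [Function.update_of_ne h]
    fun_prop

lemma dirDeriv_comp_update {F : (Fin n → ℂ) → (Fin n → ℂ)} {j k : Fin n} (hjk : j ≠ k) (t : ℂ)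
    {z : Fin n → ℂ} (hF : DifferentiableAt ℂ F (Function.update z k t)) :
    dirDeriv j (fun w => F (Function.update w k t)) z = dirDeriv j F (Function.update z k t) := by
  have hz : Function.update z j (z j) = z := Function.update_eq_self j z
  have hz' : Function.update (Function.update z k t) j (z j) = Function.update z k t := by
    conv_lhs => rw [← Function.update_of_ne hjk t z, Function.update_eq_self]
  have h1 : DifferentiableAt ℂ (fun w => F (Function.update w k t))
      (Function.update z j (z j)) := by
    rw [hz]
    exact DifferentiableAt.comp z hF (differentiable_update k t z)
  have h2 := hasDerivAt_dirDeriv h1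
  have h3 := hasDerivAt_dirDeriv (F := F) (z := Function.update z k t) (i := j) (t := z j)
    (by rwa [hz'])
  rw [hz] at h2
  rw [hz'] at h3
  have h4 : (fun s => F (Function.update (Function.update z j s) k t)) =
      fun s => F (Function.update (Function.update z k t) j s) := by
    funext s
    rw [Function.update_comm hjk]
  rw [h4] at h2
  exact h2.unique h3

section line

variable {f : (Fin n → ℂ) → (Fin n → ℂ)} {α : ℝ}

lemma hasDerivAt_coeff_update (f : (Fin n → ℂ) → (Fin n → ℂ)) {F : (Fin n → ℂ) → (Fin n → ℂ)}
    (hF : DifferentiableOn ℂ F (polydisk n)) {z : Fin n → ℂ} (hz : z ∈ polydisk n) (m k : Fin n)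
    {t : ℂ} (ht : t ∈ ball (0 : ℂ) 1) :
    HasDerivAt (fun t => coeff f z m (F (Function.update z k t)))
      (coeff f z m (dirDeriv k F (Function.update z k t))) t :=
  (coeff f z m).hasFDerivAt.comp_hasDerivAt t (hasDerivAt_dirDeriv
    (hF.differentiableAt (isOpen_polydisk.mem_nhds (update_mem_polydisk hz k ht))))

lemma differentiableOn_conn_update (hf : LocallyBiholomorphicOn f (polydisk n)) {z : Fin n → ℂ}
    (hz : z ∈ polydisk n) (i j k : Fin n) :
    DifferentiableOn ℂ (fun t => conn f i j (Function.update z k t)) (ball 0 1) := fun _ ht =>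
  (hasDerivAt_pd ((differentiableOn_conn hf i j).differentiableAt
    (isOpen_polydisk.mem_nhds (update_mem_polydisk hz k ht)))).differentiableAt.differentiableWithinAt

lemma mem_ball_of_mem_polydisk {z : Fin n → ℂ} (hz : z ∈ polydisk n) (k : Fin n) :
    z k ∈ ball (0 : ℂ) 1 := by simpa using hz k

lemma hasDerivAt_lineSpeed_aux (hf : LocallyBiholomorphicOn f (polydisk n))
    (hS : schwarzianNorm f ≤ (α : EReal)) {z : Fin n → ℂ} (hz : z ∈ polydisk n) (m k : Fin n)
    {t : ℂ} (ht : t ∈ ball (0 : ℂ) 1) :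
    HasDerivAt (fun t => coeff f z m (dirDeriv k f (Function.update z k t)))
      (conn f k k (Function.update z k t) *
        coeff f z m (dirDeriv k f (Function.update z k t))) t := by
  have h := hasDerivAt_coeff_update f (differentiableOn_frame hf k) hz m k ht
  rwa [hess_self hf hS (update_mem_polydisk hz k ht), map_smul, smul_eq_mul] at h

/-- This coordinate solves a homogeneous linear equation along the disk and vanishes at `t = z k`.
-/
lemma coeff_frame_update_of_ne (hf : LocallyBiholomorphicOn f (polydisk n))
    (hS : schwarzianNorm f ≤ (α : EReal)) {z : Fin n → ℂ} (hz : z ∈ polydisk n) {m k : Fin n}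
    (hmk : m ≠ k) {t : ℂ} (ht : t ∈ ball (0 : ℂ) 1) :
    coeff f z m (dirDeriv k f (Function.update z k t)) = 0 := by
  refine eq_zero_of_linear (differentiableOn_conn_update hf hz k k k)
    (fun t ht => hasDerivAt_lineSpeed_aux hf hS hz m k ht) (mem_ball_of_mem_polydisk hz k) ?_ ht
  rw [Function.update_eq_self, coeff_frame_of_ne hf hz hmk]

lemma hasDerivAt_lineCoord (hf : LocallyBiholomorphicOn f (polydisk n)) {z : Fin n → ℂ}
    (hz : z ∈ polydisk n) (k : Fin n) {t : ℂ} (ht : t ∈ ball (0 : ℂ) 1) :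
    HasDerivAt (fun t => lineCoord f k t z) (lineSpeed f k t z) t := by
  have h := (hasDerivAt_coeff_update f hf.differentiableOn hz k k ht).sub_const (coeff f z k (f z))
  simpa only [lineCoord, lineSpeed, map_sub] using h

lemma line_eq (hf : LocallyBiholomorphicOn f (polydisk n))
    (hS : schwarzianNorm f ≤ (α : EReal)) {z : Fin n → ℂ} (hz : z ∈ polydisk n) (k : Fin n)
    {t : ℂ} (ht : t ∈ ball (0 : ℂ) 1) :
    f (Function.update z k t) = f z + lineCoord f k t z • dirDeriv k f z := by
  refine frame_ext hf hz fun m => ?_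
  rw [map_add, map_smul, smul_eq_mul]
  rcases eq_or_ne m k with rfl | h
  · rw [coeff_frame_self hf hz, mul_one, lineCoord, map_sub]
    ring
  · rw [coeff_frame_of_ne hf hz h, mul_zero, add_zero]
    have h1 : ∀ t ∈ ball (0 : ℂ) 1,
        HasDerivAt (fun t => coeff f z m (f (Function.update z k t))) 0 t := by
      intro t ht
      have h2 := hasDerivAt_coeff_update f hf.differentiableOn hz m k ht
      rwa [coeff_frame_update_of_ne hf hS hz h ht] at h2
    have h3 := eqOn_const_of_hasDerivAt_zero h1 ht (mem_ball_of_mem_polydisk hz k)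
    simpa using h3

lemma differentiableOn_comp_update {F : (Fin n → ℂ) → (Fin n → ℂ)}
    (hF : DifferentiableOn ℂ F (polydisk n)) (k : Fin n) {t : ℂ} (ht : t ∈ ball (0 : ℂ) 1) :
    DifferentiableOn ℂ (fun w => F (Function.update w k t)) (polydisk n) :=
  hF.comp (differentiable_update k t).differentiableOn fun _ hw => update_mem_polydisk hw k ht

lemma differentiableOn_lineCoord (hf : LocallyBiholomorphicOn f (polydisk n)) (k : Fin n)
    {t : ℂ} (ht : t ∈ ball (0 : ℂ) 1) :
    DifferentiableOn ℂ (lineCoord f k t) (polydisk n) :=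
  differentiableOn_coeff hf subset_rfl
    ((differentiableOn_comp_update hf.differentiableOn k ht).sub hf.differentiableOn) k

lemma differentiableOn_lineFactor (hf : LocallyBiholomorphicOn f (polydisk n)) (s k : Fin n)
    {t : ℂ} (ht : t ∈ ball (0 : ℂ) 1) :
    DifferentiableOn ℂ (lineFactor f s k t) (polydisk n) :=
  ((differentiableOn_lineCoord hf k ht).mul (differentiableOn_conn hf s k)).const_add 1

/-- Differentiate `line_eq` in the `j`-th variable and expand the mixed Hessian by `hess_mixed`. -/
lemma frame_update (hf : LocallyBiholomorphicOn f (polydisk n))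
    (hS : schwarzianNorm f ≤ (α : EReal)) {z : Fin n → ℂ} (hz : z ∈ polydisk n) {j k : Fin n}
    (hjk : j ≠ k) {t : ℂ} (ht : t ∈ ball (0 : ℂ) 1) :
    dirDeriv j f (Function.update z k t) = lineFactor f j k t z • dirDeriv j f z +
      (pd j (lineCoord f k t) z + lineCoord f k t z * conn f k j z) • dirDeriv k f z := by
  have hn := isOpen_polydisk.mem_nhds hz
  have h1 : (fun w => f (Function.update w k t)) =ᶠ[𝓝 z]
      fun w => f w + lineCoord f k t w • dirDeriv k f w := by
    filter_upwards [hn] with w hw using line_eq hf hS hw k ht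
  have h2 := dirDeriv_congr h1 j
  have hφ := (differentiableOn_lineCoord hf k ht).differentiableAt hn
  have hF := (differentiableOn_frame hf k).differentiableAt hn
  rw [dirDeriv_comp_update hjk t (hf.differentiableOn.differentiableAt
    (isOpen_polydisk.mem_nhds (update_mem_polydisk hz k ht))),
    dirDeriv_add (hf.differentiableOn.differentiableAt hn) (hφ.fun_smul hF), dirDeriv_smul hφ hF,
    hess_mixed hf hS hz hjk] at h2
  rw [h2, lineFactor]
  module

lemma coeff_frame_update (hf : LocallyBiholomorphicOn f (polydisk n))
    (hS : schwarzianNorm f ≤ (α : EReal)) {z : Fin n → ℂ} (hz : z ∈ polydisk n) {s k : Fin n}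
    (hsk : s ≠ k) {t : ℂ} (ht : t ∈ ball (0 : ℂ) 1) (j : Fin n) :
    coeff f z s (dirDeriv j f (Function.update z k t)) =
      if s = j then lineFactor f s k t z else 0 := by
  rcases eq_or_ne j k with rfl | hjk
  · rw [coeff_frame_update_of_ne hf hS hz hsk ht, if_neg hsk]
  · rw [frame_update hf hS hz hjk ht, map_add, map_smul, map_smul, coeff_frame_of_ne hf hz hsk,
      coeff_frame hf hz]
    split_ifs with h
    · subst h; simp
    · simp

/-- If the factor vanished, the functional `coeff f z s` would kill the whole frame at the moved
point, which is a basis. -/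
lemma lineFactor_ne_zero (hf : LocallyBiholomorphicOn f (polydisk n))
    (hS : schwarzianNorm f ≤ (α : EReal)) {z : Fin n → ℂ} (hz : z ∈ polydisk n) {s k : Fin n}
    (hsk : s ≠ k) {t : ℂ} (ht : t ∈ ball (0 : ℂ) 1) : lineFactor f s k t z ≠ 0 := by
  intro h0
  have hz' := update_mem_polydisk hz k ht
  have h1 := coeff_frame_self hf hz s
  have h2 := sum_coeff_smul_frame hf hz' (dirDeriv s f z)
  rw [← h2, map_sum] at h1
  refine zero_ne_one (α := ℂ) (Eq.trans (Finset.sum_eq_zero fun m _ => ?_).symm h1)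
  rw [map_smul, coeff_frame_update hf hS hz hsk ht, h0]
  simp

lemma hasDerivAt_lineFactor (hf : LocallyBiholomorphicOn f (polydisk n)) {z : Fin n → ℂ}
    (hz : z ∈ polydisk n) (s k : Fin n) {t : ℂ} (ht : t ∈ ball (0 : ℂ) 1) :
    HasDerivAt (fun t => lineFactor f s k t z) (lineSpeed f k t z * conn f s k z) t :=
  ((hasDerivAt_lineCoord hf hz k ht).mul_const _).const_add 1

/-- Two expressions for the `t`-derivative of `lineFactor`: from its definition, and from its role
as the `s`-th coordinate of the moving vector `∂_s f`. -/
lemma lineSpeed_mul_conn (hf : LocallyBiholomorphicOn f (polydisk n))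
    (hS : schwarzianNorm f ≤ (α : EReal)) {z : Fin n → ℂ} (hz : z ∈ polydisk n) {s k : Fin n}
    (hsk : s ≠ k) {t : ℂ} (ht : t ∈ ball (0 : ℂ) 1) :
    lineSpeed f k t z * conn f s k z =
      conn f s k (Function.update z k t) * lineFactor f s k t z := by
  have h1 := hasDerivAt_coeff_update f (differentiableOn_frame hf s) hz s k ht
  rw [hess_mixed hf hS (update_mem_polydisk hz k ht) hsk.symm, map_add, map_smul, map_smul,
    coeff_frame_update hf hS hz hsk ht, coeff_frame_update hf hS hz hsk ht, if_neg hsk,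
    if_pos rfl, smul_zero, zero_add, smul_eq_mul] at h1
  refine (hasDerivAt_lineFactor hf hz s k ht).unique (h1.congr_of_eventuallyEq ?_)
  filter_upwards [isOpen_ball.mem_nhds ht] with u hu
  rw [coeff_frame_update hf hS hz hsk hu, if_pos rfl]

/-- The derivative of `ψ = φ / μ` in `t` is `φ' / μ²`, whose logarithmic derivative is `Γ^k_kk - 2
Γ^s_sk` at the moving point. Thus `norm_sub_id_le` applies with `c = 3β/2`. -/
lemma norm_normCoord_sub_le (hf : LocallyBiholomorphicOn f (polydisk n))
    (hS : schwarzianNorm f ≤ (α : EReal)) (hα0 : 0 ≤ Real.sqrt 2 * α)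
    (hα : Real.sqrt 2 * α ≤ 1 / 12.2) {z : Fin n → ℂ} (hz : z ∈ polydisk n) {s k : Fin n}
    (hsk : s ≠ k) (hzk : z k = 0) {t : ℂ} (ht : t ∈ ball (0 : ℂ) 1) :
    ‖normCoord f s k t z - t‖ ≤ 3 * (Real.sqrt 2 * α) := by
  have hz0 : Function.update z k 0 = z := by rw [← hzk, Function.update_eq_self]
  have hL0 : lineCoord f k 0 z = 0 := by rw [lineCoord, hz0, sub_self, map_zero]
  have hF0 : lineFactor f s k 0 z = 1 := by rw [lineFactor, hL0]; ring
  have key := norm_sub_id_le (c := 3 / 2 * (Real.sqrt 2 * α))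
    (κ := fun t => conn f k k (Function.update z k t) - 2 * conn f s k (Function.update z k t))
    (R := fun t => lineSpeed f k t z / lineFactor f s k t z ^ 2)
    (ψ := fun t => normCoord f s k t z) (by positivity) (by norm_num at hα ⊢; linarith)
    ((differentiableOn_conn_update hf hz k k k).sub
      ((differentiableOn_conn_update hf hz s k k).const_mul 2)) ?_ ?_ ?_ ?_ ?_ ht
  · linarith
  · intro t ht
    have := norm_conn_self_sub_le hf hS (update_mem_polydisk hz k ht) hsk
    rw [Function.update_self] at this
    refine this.trans (le_of_eq ?_)
    ring
  · intro t ht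
    have hne := lineFactor_ne_zero hf hS hz hsk ht
    have h1 : HasDerivAt (fun t => lineSpeed f k t z)
        (conn f k k (Function.update z k t) * lineSpeed f k t z) t :=
      hasDerivAt_lineSpeed_aux hf hS hz k k ht
    have h2 := hasDerivAt_lineFactor hf hz s k ht
    rw [lineSpeed_mul_conn hf hS hz hsk ht] at h2
    have h3 := h1.div (h2.pow 2) (pow_ne_zero 2 hne)
    refine h3.congr_deriv ?_
    simp only [Pi.pow_apply]
    field_simp
    ring
  · simp only [hF0]
    rw [lineSpeed, hz0, coeff_frame_self hf hz]
    simp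
  · intro t ht
    have hne := lineFactor_ne_zero hf hS hz hsk ht
    refine ((hasDerivAt_lineCoord hf hz k ht).div (hasDerivAt_lineFactor hf hz s k ht)
      hne).congr_deriv ?_
    rw [lineFactor]
    congr 1
    ring
  · rw [normCoord, hL0, zero_div]

/-- The constant comes from `1 + 3/12.2 < 5/4`. -/
lemma norm_normCoord_le (hf : LocallyBiholomorphicOn f (polydisk n))
    (hS : schwarzianNorm f ≤ (α : EReal)) (hα0 : 0 ≤ Real.sqrt 2 * α)
    (hα : Real.sqrt 2 * α ≤ 1 / 12.2) {z : Fin n → ℂ} (hz : z ∈ polydisk n) {s k : Fin n}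
    (hsk : s ≠ k) (hzk : z k = 0) {t : ℂ} (ht : t ∈ ball (0 : ℂ) 1) :
    ‖normCoord f s k t z‖ ≤ 5 / 4 := by
  have h1 := norm_normCoord_sub_le hf hS hα0 hα hz hsk hzk ht
  have h2 : ‖t‖ < 1 := by simpa using ht
  have h3 := norm_add_le (normCoord f s k t z - t) t
  rw [sub_add_cancel] at h3
  norm_num at hα
  linarith

lemma differentiableOn_normCoord (hf : LocallyBiholomorphicOn f (polydisk n))
    (hS : schwarzianNorm f ≤ (α : EReal)) {s k : Fin n} (hsk : s ≠ k) {t : ℂ}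
    (ht : t ∈ ball (0 : ℂ) 1) : DifferentiableOn ℂ (normCoord f s k t) (polydisk n) := by
  have : normCoord f s k t = fun z => lineCoord f k t z * (lineFactor f s k t z)⁻¹ := by
    funext z; rw [normCoord, div_eq_mul_inv]
  rw [this]
  exact (differentiableOn_lineCoord hf k ht).mul ((differentiableOn_lineFactor hf s k ht).inv
    fun z hz => lineFactor_ne_zero hf hS hz hsk ht)

/-- Subtracting `t`, which does not depend on `z`, before applying Cauchy's estimate gives a bound
of order `β` rather than `5/4`. -/
lemma norm_pd_normCoord_le (hf : LocallyBiholomorphicOn f (polydisk n))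
    (hS : schwarzianNorm f ≤ (α : EReal)) (hα0 : 0 ≤ Real.sqrt 2 * α)
    (hα : Real.sqrt 2 * α ≤ 1 / 12.2) {z : Fin n → ℂ} (hz : z ∈ polydisk n) {s k j : Fin n}
    (hsk : s ≠ k) (hjk : j ≠ k) (hzk : z k = 0) (hzj : z j = 0) {t : ℂ}
    (ht : t ∈ ball (0 : ℂ) 1) :
    ‖pd j (normCoord f s k t) z‖ ≤ 3 * (Real.sqrt 2 * α) := by
  have h1 : pd j (normCoord f s k t) z = pd j (fun w => normCoord f s k t w - t) z := by
    unfold pd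
    rw [fderiv_sub_const]
  rw [h1]
  refine norm_pd_le isOpen_polydisk ((differentiableOn_normCoord hf hS hsk ht).sub_const t) hzj
    (fun u hu => update_mem_polydisk hz j hu) fun u hu => ?_
  exact norm_normCoord_sub_le hf hS hα0 hα (update_mem_polydisk hz j hu) hsk
    (by rw [Function.update_of_ne hjk.symm, hzk]) ht

lemma pd_lineFactor (hf : LocallyBiholomorphicOn f (polydisk n)) {z : Fin n → ℂ}
    (hz : z ∈ polydisk n) (s k j : Fin n) {t : ℂ} (ht : t ∈ ball (0 : ℂ) 1) :
    pd j (lineFactor f s k t) z = pd j (lineCoord f k t) z * conn f s k z +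
      lineCoord f k t z * pd j (conn f s k) z := by
  have hn := isOpen_polydisk.mem_nhds hz
  rw [← pd_mul ((differentiableOn_lineCoord hf k ht).differentiableAt hn)
    ((differentiableOn_conn hf s k).differentiableAt hn)]
  unfold lineFactor pd
  rw [fderiv_const_add]

lemma pd_normCoord (hf : LocallyBiholomorphicOn f (polydisk n))
    (hS : schwarzianNorm f ≤ (α : EReal)) {z : Fin n → ℂ}
    (hz : z ∈ polydisk n) {s k : Fin n} (hsk : s ≠ k) (j : Fin n) {t : ℂ}
    (ht : t ∈ ball (0 : ℂ) 1) :
    pd j (normCoord f s k t) z = (pd j (lineCoord f k t) z * lineFactor f s k t z -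
      lineCoord f k t z * (pd j (lineCoord f k t) z * conn f s k z +
      lineCoord f k t z * pd j (conn f s k) z)) / lineFactor f s k t z ^ 2 := by
  have hn := isOpen_polydisk.mem_nhds hz
  rw [← pd_lineFactor hf hz s k j ht]
  exact pd_div ((differentiableOn_lineCoord hf k ht).differentiableAt hn)
    ((differentiableOn_lineFactor hf s k ht).differentiableAt hn)
    (lineFactor_ne_zero hf hS hz hsk ht) j

/-- Differentiate `frame_update`, for the vector `∂_s f`, in the `j`-th variable and read off the
`s`-th coordinate in the frame at `z`. -/
lemma conn_update_mul (hf : LocallyBiholomorphicOn f (polydisk n))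
    (hS : schwarzianNorm f ≤ (α : EReal)) {z : Fin n → ℂ} (hz : z ∈ polydisk n) {s k j : Fin n}
    (hsk : s ≠ k) (hjk : j ≠ k) {t : ℂ} (ht : t ∈ ball (0 : ℂ) 1) :
    conn f s j (Function.update z k t) * lineFactor f s k t z =
      pd j (lineCoord f k t) z * conn f s k z + lineCoord f k t z * pd j (conn f s k) z +
      lineFactor f s k t z * conn f s j z +
      (pd s (lineCoord f k t) z + lineCoord f k t z * conn f k s z) *
        coeff f z s (dirDeriv j (dirDeriv k f) z) := by
  have hn := isOpen_polydisk.mem_nhds hz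
  have hz' := update_mem_polydisk hz k ht
  have h1 : (fun w => dirDeriv s f (Function.update w k t)) =ᶠ[𝓝 z]
      fun w => lineFactor f s k t w • dirDeriv s f w +
      (pd s (lineCoord f k t) w + lineCoord f k t w * conn f k s w) • dirDeriv k f w := by
    filter_upwards [hn] with w hw using frame_update hf hS hw hsk ht
  have h2 := congrArg (coeff f z s) (dirDeriv_congr h1 j)
  have hμ := (differentiableOn_lineFactor hf s k ht).differentiableAt hn
  have hφ := differentiableOn_lineCoord hf k ht
  have hν : DifferentiableAt ℂ
      (fun w => pd s (lineCoord f k t) w + lineCoord f k t w * conn f k s w) z :=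
    ((differentiableOn_pd isOpen_polydisk hφ s).add
      (hφ.mul (differentiableOn_conn hf k s))).differentiableAt hn
  have hFs := (differentiableOn_frame hf s).differentiableAt hn
  have hFk := (differentiableOn_frame hf k).differentiableAt hn
  have hLHS : coeff f z s (dirDeriv j (dirDeriv s f) (Function.update z k t)) =
      conn f s j (Function.update z k t) * lineFactor f s k t z := by
    rcases eq_or_ne j s with rfl | hjs
    · rw [hess_self hf hS hz', map_smul, coeff_frame_update hf hS hz hsk ht, if_pos rfl,
        smul_eq_mul]
    · rw [hess_mixed hf hS hz' hjs, map_add, map_smul, map_smul,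
        coeff_frame_update hf hS hz hsk ht, coeff_frame_update hf hS hz hsk ht, if_pos rfl,
        if_neg hjs.symm, smul_zero, zero_add, smul_eq_mul]
  rw [dirDeriv_comp_update hjk t ((differentiableOn_frame hf s).differentiableAt
    (isOpen_polydisk.mem_nhds hz')), hLHS, dirDeriv_add (hμ.fun_smul hFs) (hν.fun_smul hFk),
    dirDeriv_smul hμ hFs, dirDeriv_smul hν hFk, pd_lineFactor hf hz s k j ht] at h2
  simp only [map_add, map_smul, smul_eq_mul, coeff_frame_self hf hz,
    coeff_frame_of_ne hf hz hsk, coeff_hess_right hf hz] at h2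
  rw [h2]
  ring

end line

/-! ### Transport of the coefficients of the normalized map -/

lemma transport_algebra_self {φ φs γ Γ dγ g g' x y D μ : ℂ} (hμ : μ = 1 + φ * γ) (hμ0 : μ ≠ 0)
    (hD : D ≠ 0) (hD' : D + φ * x ≠ 0)
    (hg : g' * μ = φs * γ + φ * dγ + μ * g + (φs + φ * Γ) * γ) :
    ((μ * y + (φs + φ * Γ) * x) / (D + φ * x) - g' / 2) * (1 + (x / D - γ) * (φ / μ)) =
      (y / D - g / 2) + (x / D - γ) *
        ((φs * μ - φ * (φs * γ + φ * dγ)) / μ ^ 2 - (g - 2 * Γ) / 2 * (φ / μ)) +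
      (Γ * γ - dγ) / 2 * (φ / μ) * (1 - (x / D - γ) * (φ / μ)) := by
  obtain rfl : g' = (φs * γ + φ * dγ + μ * g + (φs + φ * Γ) * γ) / μ := by
    rw [eq_div_iff hμ0, hg]
  -- The multiplier `1 + Q ψ` is the new denominator `D + φ x` divided by `D μ`, so multiplying by
  -- it clears the new denominator.
  have h1 : 1 + (x / D - γ) * (φ / μ) = (D + φ * x) / (D * μ) := by
    field_simp
    rw [hμ]; ring
  rw [h1]
  field_simp
  subst hμ
  ring

/-- Dictionary: `φ`, `μ`, `μj` are `lineCoord` and the factors for `s` and `j`; `φj` is `∂_j φ`;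
`γ`, `γj`, `Γ`, `G` are `Γ^s_sk`, `Γ^j_jk`, `Γ^k_kj`, `Γ^s_sj`; `dγ` is `∂_j γ`; `g'` is `G` at the
moved point; `x`, `y` are `A` on `∂_k f`, `∂_j f`. The self case is analogous, with `j = s`. -/
lemma transport_algebra_mixed {φ φj γ γj Γ G dγ g' x y D μ μj : ℂ} (hμ : μ = 1 + φ * γ)
    (hμ0 : μ ≠ 0) (hμj : μj = 1 + φ * γj) (hD : D ≠ 0) (hD' : D + φ * x ≠ 0)
    (hdγ : dγ = Γ * γ + γj * G - γ * G) (hg : g' * μ = φj * γ + φ * dγ + μ * G) :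
    ((μj * y + (φj + φ * Γ) * x) / (D + φ * x) - g') * (1 + (x / D - γ) * (φ / μ)) =
      (y / D - G) * (1 + (γj - γ) * (φ / μ)) + (x / D - γ) *
        ((φj * μ - φ * (φj * γ + φ * dγ)) / μ ^ 2 + φ / μ * (Γ - G)) := by
  obtain rfl : g' = (φj * γ + φ * dγ + μ * G) / μ := by
    rw [eq_div_iff hμ0, hg]
  have h1 : 1 + (x / D - γ) * (φ / μ) = (D + φ * x) / (D * μ) := by
    field_simp
    rw [hμ]; ring
  rw [h1]
  field_simp
  subst hμ hμj hdγ
  ring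

/-- The affine function `1 + A ∘ f`. -/
def den (A : (Fin n → ℂ) →L[ℂ] ℂ) (f : (Fin n → ℂ) → (Fin n → ℂ)) (z : Fin n → ℂ) : ℂ :=
  1 + A (f z)

/-- The connection coefficient `-Γ^s_{sj}` of the map `f / (1 + A ∘ f)`. -/
def mixedInv (A : (Fin n → ℂ) →L[ℂ] ℂ) (f : (Fin n → ℂ) → (Fin n → ℂ)) (s j : Fin n)
    (z : Fin n → ℂ) : ℂ :=
  A (dirDeriv j f z) / den A f z - conn f s j z

/-- Half of the connection coefficient `-Γ^s_{ss}` of the map `f / (1 + A ∘ f)`. -/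
def selfInv (A : (Fin n → ℂ) →L[ℂ] ℂ) (f : (Fin n → ℂ) → (Fin n → ℂ)) (s : Fin n)
    (z : Fin n → ℂ) : ℂ :=
  A (dirDeriv s f z) / den A f z - conn f s s z / 2

section transport

variable {f : (Fin n → ℂ) → (Fin n → ℂ)} {α : ℝ} (A : (Fin n → ℂ) →L[ℂ] ℂ)

lemma den_update (hf : LocallyBiholomorphicOn f (polydisk n))
    (hS : schwarzianNorm f ≤ (α : EReal)) {z : Fin n → ℂ} (hz : z ∈ polydisk n) (k : Fin n)
    {t : ℂ} (ht : t ∈ ball (0 : ℂ) 1) :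
    den A f (Function.update z k t) = den A f z + lineCoord f k t z * A (dirDeriv k f z) := by
  rw [den, line_eq hf hS hz k ht, map_add, map_smul, smul_eq_mul, den, add_assoc]

/-- `D` is affine in `lineCoord`; dividing by `lineFactor` leaves a factor affine in `normCoord`,
whose slope is an invariant of the normalized map. -/
lemma den_update_eq_mul (hf : LocallyBiholomorphicOn f (polydisk n))
    (hS : schwarzianNorm f ≤ (α : EReal)) {z : Fin n → ℂ} (hz : z ∈ polydisk n) {s k : Fin n}
    (hsk : s ≠ k) {t : ℂ} (ht : t ∈ ball (0 : ℂ) 1) (hD : den A f z ≠ 0) :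
    den A f (Function.update z k t) = den A f z * lineFactor f s k t z *
      (1 + mixedInv A f s k z * normCoord f s k t z) := by
  have h := lineFactor_ne_zero hf hS hz hsk ht
  rw [den_update A hf hS hz k ht, mixedInv, normCoord]
  field_simp
  rw [lineFactor]
  ring

lemma den_update_ne_zero (hf : LocallyBiholomorphicOn f (polydisk n))
    (hS : schwarzianNorm f ≤ (α : EReal)) (hα0 : 0 ≤ Real.sqrt 2 * α)
    (hα : Real.sqrt 2 * α ≤ 1 / 12.2) {z : Fin n → ℂ} (hz : z ∈ polydisk n) {s k : Fin n}
    (hsk : s ≠ k) (hzk : z k = 0) {t : ℂ} (ht : t ∈ ball (0 : ℂ) 1) (hD : den A f z ≠ 0)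
    (hQ : ‖mixedInv A f s k z‖ * (5 / 4) < 1) : den A f (Function.update z k t) ≠ 0 := by
  rw [den_update_eq_mul A hf hS hz hsk ht hD]
  refine mul_ne_zero (mul_ne_zero hD (lineFactor_ne_zero hf hS hz hsk ht)) fun h => ?_
  have h1 := norm_normCoord_le hf hS hα0 hα hz hsk hzk ht
  have h2 : mixedInv A f s k z * normCoord f s k t z = -1 := by linear_combination h
  have h3 := congrArg norm h2
  rw [norm_mul, norm_neg, norm_one] at h3
  nlinarith [norm_nonneg (mixedInv A f s k z)]

/-- Every coefficient on the right is controlled by the Schwarzian: a Cauchy estimate for `ψ`, the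
first-order combination `Γ^s_ss - 2 Γ^k_ks`, and the second-order one of `norm_pd_conn_sub_le`. -/
lemma selfInv_update (hf : LocallyBiholomorphicOn f (polydisk n))
    (hS : schwarzianNorm f ≤ (α : EReal)) {z : Fin n → ℂ} (hz : z ∈ polydisk n) {s k : Fin n}
    (hsk : s ≠ k) {t : ℂ} (ht : t ∈ ball (0 : ℂ) 1) (hD : den A f z ≠ 0)
    (hD' : den A f (Function.update z k t) ≠ 0) :
    selfInv A f s (Function.update z k t) * (1 + mixedInv A f s k z * normCoord f s k t z) =
      selfInv A f s z + mixedInv A f s k z * (pd s (normCoord f s k t) z -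
        (conn f s s z - 2 * conn f k s z) / 2 * normCoord f s k t z) +
      (conn f k s z * conn f s k z - pd s (conn f s k) z) / 2 * normCoord f s k t z *
        (1 - mixedInv A f s k z * normCoord f s k t z) := by
  have hg := conn_update_mul hf hS hz hsk hsk ht
  rw [coeff_hess_left] at hg
  have hAs : A (dirDeriv s f (Function.update z k t)) =
      lineFactor f s k t z * A (dirDeriv s f z) +
        (pd s (lineCoord f k t) z + lineCoord f k t z * conn f k s z) * A (dirDeriv k f z) := by
    rw [frame_update hf hS hz hsk ht, map_add, map_smul, map_smul, smul_eq_mul, smul_eq_mul]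
  rw [den_update A hf hS hz k ht] at hD'
  rw [selfInv, selfInv, mixedInv, hAs, den_update A hf hS hz k ht, pd_normCoord hf hS hz hsk s ht,
    normCoord]
  exact transport_algebra_self rfl (lineFactor_ne_zero hf hS hz hsk ht) hD hD' hg

lemma mixedInv_update (hf : LocallyBiholomorphicOn f (polydisk n))
    (hS : schwarzianNorm f ≤ (α : EReal)) {z : Fin n → ℂ} (hz : z ∈ polydisk n) {s k j : Fin n}
    (hsk : s ≠ k) (hjk : j ≠ k) (hjs : j ≠ s) {t : ℂ} (ht : t ∈ ball (0 : ℂ) 1)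
    (hD : den A f z ≠ 0) (hD' : den A f (Function.update z k t) ≠ 0) :
    mixedInv A f s j (Function.update z k t) * (1 + mixedInv A f s k z * normCoord f s k t z) =
      mixedInv A f s j z * (1 + (conn f j k z - conn f s k z) * normCoord f s k t z) +
      mixedInv A f s k z * (pd j (normCoord f s k t) z +
        normCoord f s k t z * (conn f k j z - conn f s j z)) := by
  have hg := conn_update_mul hf hS hz hsk hjk ht
  rw [coeff_hess_eq_zero hf hS hz hjs.symm hsk, mul_zero, add_zero] at hg
  have hAj : A (dirDeriv j f (Function.update z k t)) =
      lineFactor f j k t z * A (dirDeriv j f z) +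
        (pd j (lineCoord f k t) z + lineCoord f k t z * conn f k j z) * A (dirDeriv k f z) := by
    rw [frame_update hf hS hz hjk ht, map_add, map_smul, map_smul, smul_eq_mul, smul_eq_mul]
  rw [den_update A hf hS hz k ht] at hD'
  rw [mixedInv, mixedInv, mixedInv, hAj, den_update A hf hS hz k ht,
    pd_normCoord hf hS hz hsk j ht, normCoord]
  exact transport_algebra_mixed rfl (lineFactor_ne_zero hf hS hz hsk ht) rfl hD hD'
    (pd_conn_of_distinct hf hS hz hjk hjs hsk.symm) hg

lemma one_sub_mul_norm_le {Q ψ : ℂ} {x : ℂ} {q : ℝ} (hψ : ‖ψ‖ ≤ 5 / 4) (hQ : ‖Q‖ ≤ q) :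
    (1 - q * (5 / 4)) * ‖x‖ ≤ ‖x * (1 + Q * ψ)‖ := by
  have hq : 0 ≤ q := (norm_nonneg _).trans hQ
  have h1 : ‖Q * ψ‖ ≤ q * (5 / 4) := by
    rw [norm_mul]; gcongr
  have h2 := norm_sub_le (1 + Q * ψ) (Q * ψ)
  rw [add_sub_cancel_right, norm_one] at h2
  rw [norm_mul, mul_comm]
  gcongr
  linarith

lemma norm_selfInv_update_le (hf : LocallyBiholomorphicOn f (polydisk n))
    (hS : schwarzianNorm f ≤ (α : EReal)) {β : ℝ} (hβ : β = Real.sqrt 2 * α) (hβ0 : 0 ≤ β)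
    (hβ1 : β ≤ 1 / 12.2) {z : Fin n → ℂ} (hz : z ∈ polydisk n) {s k : Fin n}
    (hsk : s ≠ k) (hzk : z k = 0) (hzs : z s = 0) {t : ℂ} (ht : t ∈ ball (0 : ℂ) 1)
    (hD : den A f z ≠ 0) (hQ : ‖mixedInv A f s k z‖ ≤ 3 * β) :
    (1 - 15 / 4 * β) * ‖selfInv A f s (Function.update z k t)‖ ≤
      ‖selfInv A f s z‖ + 37 / 10 * β := by
  subst hβ
  have hψ := norm_normCoord_le hf hS hβ0 hβ1 hz hsk hzk ht
  have hψs := norm_pd_normCoord_le hf hS hβ0 hβ1 hz hsk hsk hzk hzs ht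
  have hd := norm_conn_self_sub_le hf hS hz hsk.symm
  rw [hzs, norm_zero] at hd
  have hX := norm_pd_conn_sub_le hf hS hz hsk.symm hzk hzs
  have hD' := den_update_ne_zero A hf hS hβ0 hβ1 hz hsk hzk ht hD (by norm_num at hβ1; linarith)
  have key := selfInv_update A hf hS hz hsk ht hD hD'
  have h1 := one_sub_mul_norm_le (x := selfInv A f s (Function.update z k t)) hψ hQ
  rw [key] at h1
  set β := Real.sqrt 2 * α
  set ψ := normCoord f s k t z
  set Q := mixedInv A f s k z
  have e1 : ‖(conn f s s z - 2 * conn f k s z) / 2 * ψ‖ ≤ 3 / 2 * β * (5 / 4) := by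
    rw [norm_mul, norm_div, Complex.norm_two]
    gcongr
    norm_num at hd
    linarith
  have e2 : ‖Q * (pd s (normCoord f s k t) z -
      (conn f s s z - 2 * conn f k s z) / 2 * ψ)‖ ≤ 3 * β * (3 * β + 3 / 2 * β * (5 / 4)) := by
    rw [norm_mul]
    gcongr
    exact (norm_sub_le _ _).trans (add_le_add hψs e1)
  have e3 : ‖Q * ψ‖ ≤ 3 * β * (5 / 4) := by
    rw [norm_mul]; gcongr
  have e4 : ‖1 - Q * ψ‖ ≤ 1 + 3 * β * (5 / 4) := by
    refine (norm_sub_le _ _).trans ?_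
    rw [norm_one]
    linarith
  have e5 : ‖(conn f k s z * conn f s k z - pd s (conn f s k) z) / 2 * ψ * (1 - Q * ψ)‖ ≤
      3 * β / 2 * (5 / 4) * (1 + 3 * β * (5 / 4)) := by
    rw [norm_mul, norm_mul, norm_div, Complex.norm_two]
    gcongr
  have e6 := norm_add₃_le (a := selfInv A f s z) (b := Q * (pd s (normCoord f s k t) z -
      (conn f s s z - 2 * conn f k s z) / 2 * ψ))
    (c := (conn f k s z * conn f s k z - pd s (conn f s k) z) / 2 * ψ * (1 - Q * ψ))
  -- The error is at most `15/8 β + (117/8 + 225/32) β²`, which is below `37/10 β` for `β ≤ 1/12.2`.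
  norm_num at hβ1
  nlinarith

/-- The `8` collects `5/2` from each of the two connection differences and `3` from the derivative
of `ψ`. -/
lemma norm_mixedInv_update_le (hf : LocallyBiholomorphicOn f (polydisk n))
    (hS : schwarzianNorm f ≤ (α : EReal)) {β : ℝ} (hβ : β = Real.sqrt 2 * α) (hβ0 : 0 ≤ β)
    (hβ1 : β ≤ 1 / 12.2) {z : Fin n → ℂ} (hz : z ∈ polydisk n) {s k j : Fin n}
    (hsk : s ≠ k) (hjk : j ≠ k) (hjs : j ≠ s) (hzk : z k = 0) (hzj : z j = 0) {t : ℂ}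
    (ht : t ∈ ball (0 : ℂ) 1) (hD : den A f z ≠ 0) {ρ : ℝ} (hρ : ρ ≤ 3 * β)
    (hQk : ‖mixedInv A f s k z‖ ≤ ρ) (hQj : ‖mixedInv A f s j z‖ ≤ ρ) :
    (1 - ρ * (5 / 4)) * ‖mixedInv A f s j (Function.update z k t)‖ ≤ ρ * (1 + 8 * β) := by
  subst hβ
  have hψ := norm_normCoord_le hf hS hβ0 hβ1 hz hsk hzk ht
  have hψj := norm_pd_normCoord_le hf hS hβ0 hβ1 hz hsk hjk hzk hzj ht
  have he := norm_conn_sub_conn_le hf hS hz hsk hjk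
  have he' := norm_conn_sub_conn_le hf hS hz hjs.symm hjk.symm
  rw [hzk, norm_zero] at he
  rw [hzj, norm_zero] at he'
  have hD' := den_update_ne_zero A hf hS hβ0 hβ1 hz hsk hzk ht hD (by norm_num at hβ1; linarith)
  have key := mixedInv_update A hf hS hz hsk hjk hjs ht hD hD'
  have h1 := one_sub_mul_norm_le (x := mixedInv A f s j (Function.update z k t)) hψ hQk
  rw [key] at h1
  set β := Real.sqrt 2 * α
  set ψ := normCoord f s k t z
  have hρ0 : 0 ≤ ρ := (norm_nonneg _).trans hQk
  have e1 : ‖mixedInv A f s j z * (1 + (conn f j k z - conn f s k z) * ψ)‖ ≤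
      ρ * (1 + 2 * β * (5 / 4)) := by
    rw [norm_mul]
    gcongr
    refine (norm_add_le _ _).trans ?_
    rw [norm_one, norm_mul]
    gcongr
    norm_num at he
    linarith
  have e2 : ‖mixedInv A f s k z * (pd j (normCoord f s k t) z +
      ψ * (conn f k j z - conn f s j z))‖ ≤ ρ * (3 * β + 5 / 4 * (2 * β)) := by
    rw [norm_mul]
    gcongr
    refine (norm_add_le _ _).trans (add_le_add hψj ?_)
    rw [norm_mul]
    gcongr
    norm_num at he'
    linarith
  refine h1.trans ((norm_add_le _ _).trans ((add_le_add e1 e2).trans (le_of_eq ?_)))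
  ring

end transport

/-! ### The normalization at the origin -/

/-- The linear form `w ↦ a₁ w₁ + ⋯ + aₙ wₙ`. -/
def linForm (a : Fin n → ℂ) : (Fin n → ℂ) →L[ℂ] ℂ :=
  ∑ i, a i • (ContinuousLinearMap.proj i : (Fin n → ℂ) →L[ℂ] ℂ)

lemma linForm_apply (a w : Fin n → ℂ) : linForm a w = ∑ i, a i * w i := by
  simp [linForm, sum_apply]

lemma den_linForm (a : Fin n → ℂ) (f : (Fin n → ℂ) → (Fin n → ℂ)) (z : Fin n → ℂ) :
    den (linForm a) f z = 1 + ∑ i, a i * f z i := by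
  rw [den, linForm_apply]

lemma zero_mem_polydisk : (0 : Fin n → ℂ) ∈ polydisk n := fun i => by simp

section normalization

variable {f : (Fin n → ℂ) → (Fin n → ℂ)} {α : ℝ}

lemma frame_zero (hf : LocallyBiholomorphicOn f (polydisk n)) (h1 : jacobiMatrix f 0 = 1)
    (j : Fin n) : dirDeriv j f 0 = Pi.single j 1 := by
  funext l
  rw [← jacobiMatrix_apply hf zero_mem_polydisk, h1, Matrix.one_apply, Pi.single_apply]

lemma linForm_normVec_frame_zero (hf : LocallyBiholomorphicOn f (polydisk n))
    (h1 : jacobiMatrix f 0 = 1) (j : Fin n) :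
    linForm (normVec f) (dirDeriv j f 0) = pdLogJacobian j f 0 / ((n : ℂ) + 1) := by
  rw [frame_zero hf h1, linForm_apply, Finset.sum_eq_single j]
  · rw [normVec, pdLogJacobian, jacobian, h1, Matrix.det_one]
    simp
  · intro b _ hb; simp [hb]
  · simp

lemma den_zero (A : (Fin n → ℂ) →L[ℂ] ℂ) (h0 : f 0 = 0) : den A f 0 = 1 := by
  rw [den, h0, map_zero, add_zero]

/-- The choice of `a` makes this coefficient equal to `-S^s_sj(0)`; likewise `selfInv` at `0` is
`-S^s_ss(0) / 2`. -/
lemma norm_mixedInv_zero_le (hf : LocallyBiholomorphicOn f (polydisk n)) (h0 : f 0 = 0)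
    (h1 : jacobiMatrix f 0 = 1) (hS : schwarzianNorm f ≤ (α : EReal)) {s j : Fin n}
    (hsj : s ≠ j) : ‖mixedInv (linForm (normVec f)) f s j 0‖ ≤ Real.sqrt 2 * α := by
  have h := norm_schwarzian_mixed_le hf.differentiableOn hS zero_mem_polydisk hsj
  rw [schwarzian_eq_conn_of_ne hf zero_mem_polydisk hsj] at h
  rw [mixedInv, den_zero _ h0, div_one, linForm_normVec_frame_zero hf h1, norm_sub_rev]
  simpa using h

lemma norm_selfInv_zero_le (hf : LocallyBiholomorphicOn f (polydisk n)) (h0 : f 0 = 0)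
    (h1 : jacobiMatrix f 0 = 1) (hS : schwarzianNorm f ≤ (α : EReal)) (s : Fin n) :
    ‖selfInv (linForm (normVec f)) f s 0‖ ≤ 1 / 2 * (Real.sqrt 2 * α) := by
  have h := norm_schwarzian_self_le hS (zero_mem_polydisk (n := n)) s
  rw [schwarzian_eq_conn_self hf zero_mem_polydisk] at h
  rw [selfInv, den_zero _ h0, div_one, linForm_normVec_frame_zero hf h1]
  have h2 : pdLogJacobian s f 0 / ((n : ℂ) + 1) - conn f s s 0 / 2 =
      -(1 / 2) * (conn f s s 0 - 2 * (pdLogJacobian s f 0 / ((n : ℂ) + 1))) := by ring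
  rw [h2, norm_mul]
  norm_num at h ⊢
  linarith

end normalization

/-! ### Numerical estimates and the two recursions -/

section numeric

variable {x β : ℝ}

/-- `(x - 2) / x^(3/2)` is largest at `x = 6`, whence the double root in `2x³ - 27(x - 2)² = (x -
6)²(2x - 3)`. In `sub_one_mul_le` the maximum is at `x = 3`. -/
lemma sub_two_mul_le (hx : 2 ≤ x) (h : x ^ 3 * β ^ 2 ≤ 2 / 37.21) :
    (x - 2) * β ≤ 0.064 := by
  have h1 : 27 * (x - 2) ^ 2 ≤ 2 * x ^ 3 := by
    nlinarith [mul_nonneg (sq_nonneg (x - 6)) (by linarith : 0 ≤ 2 * x - 3)]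
  refine abs_le_of_sq_le_sq' ?_ (by norm_num) |>.2
  have h2 : 27 * ((x - 2) * β) ^ 2 ≤ 2 * (x ^ 3 * β ^ 2) := by
    nlinarith [mul_le_mul_of_nonneg_right h1 (sq_nonneg β)]
  norm_num at h ⊢
  linarith

lemma sub_one_mul_le (hx : 2 ≤ x) (h : x ^ 3 * β ^ 2 ≤ 2 / 37.21) :
    (x - 1) * β ≤ 0.0893 := by
  have h1 : 27 * (x - 1) ^ 2 ≤ 4 * x ^ 3 := by
    nlinarith [mul_nonneg (sq_nonneg (x - 3)) (by linarith : 0 ≤ 4 * x - 3)]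
  refine abs_le_of_sq_le_sq' ?_ (by norm_num) |>.2
  have h2 : 27 * ((x - 1) * β) ^ 2 ≤ 4 * (x ^ 3 * β ^ 2) := by
    nlinarith [mul_le_mul_of_nonneg_right h1 (sq_nonneg β)]
  norm_num at h ⊢
  linarith

lemma le_of_cube_mul_sq_le (hx : 2 ≤ x) (h : x ^ 3 * β ^ 2 ≤ 2 / 37.21) : β ≤ 1 / 12.2 := by
  have h1 : (2 : ℝ) ^ 3 ≤ x ^ 3 := by gcongr
  refine abs_le_of_sq_le_sq' ?_ (by norm_num) |>.2
  have h2 := mul_le_mul_of_nonneg_right h1 (sq_nonneg β)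
  norm_num at h h2 ⊢
  linarith

lemma cube_mul_sq_le {α : ℝ} (hx : 0 ≤ x) (hα : 0 ≤ α) (h : x * Real.sqrt x * α ≤ 1 / 6.1) :
    x ^ 3 * (Real.sqrt 2 * α) ^ 2 ≤ 2 / 37.21 := by
  have h1 : (x * Real.sqrt x * α) ^ 2 ≤ (1 / 6.1) ^ 2 := by gcongr
  have h2 : (x * Real.sqrt x * α) ^ 2 = x ^ 3 * α ^ 2 := by
    rw [mul_pow, mul_pow, Real.sq_sqrt hx]; ring
  rw [h2] at h1
  rw [mul_pow, Real.sq_sqrt zero_le_two]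
  norm_num at h1 ⊢
  linarith

/-- The recursion `ρ ↦ ρ (1 + 8β) / (1 - 5ρ/4)` is compared with one in which `β/ρ` drops by `37/4
β` per step, where `37/4 = 8 + 5/4`. -/
lemma le_div_of_mixed_step {N m : ℝ} (hβ0 : 0 ≤ β)
    (hm0 : 0 ≤ m) (hN : 0 ≤ N) (hD' : 0 < 1 - (m + 1) * (37 / 4 * β))
    (h : (1 - β / (1 - m * (37 / 4 * β)) * (5 / 4)) * N ≤
      β / (1 - m * (37 / 4 * β)) * (1 + 8 * β)) :
    N ≤ β / (1 - (m + 1) * (37 / 4 * β)) := by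
  have hD : 0 < 1 - m * (37 / 4 * β) := by nlinarith
  have h1 : (1 - m * (37 / 4 * β) - 5 / 4 * β) * N ≤ β * (1 + 8 * β) := by
    have h2 := mul_le_mul_of_nonneg_left h hD.le
    have h3 : (1 - m * (37 / 4 * β)) * (β / (1 - m * (37 / 4 * β))) = β :=
      mul_div_cancel₀ _ hD.ne'
    linear_combination h2 + (1 + 8 * β + 5 / 4 * N) * h3
  rw [le_div_iff₀ hD']
  have h5 : (1 - (m + 1) * (37 / 4 * β)) * (1 + 8 * β) ≤ 1 - m * (37 / 4 * β) - 5 / 4 * β := by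
    nlinarith [mul_nonneg (mul_nonneg hβ0 hβ0) (by linarith : 0 ≤ m + 1)]
  have h6 := (mul_le_mul_of_nonneg_right h5 hN).trans h1
  have h7 : (N * (1 - (m + 1) * (37 / 4 * β))) * (1 + 8 * β) ≤ β * (1 + 8 * β) := by linarith
  exact le_of_mul_le_mul_right h7 (by positivity)

/-- The denominators are combined by `(1 - x)(1 - m x) ≥ 1 - (m + 1) x`, with `x = 15β/4`. -/
lemma le_div_of_self_step {N T m : ℝ} (hβ0 : 0 ≤ β)
    (hm0 : 0 ≤ m) (hN : 0 ≤ N) (hE' : 0 < 1 - 15 / 4 * ((m + 1) * β))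
    (hT : T ≤ (1 / 2 + 37 / 10 * m) * β / (1 - 15 / 4 * (m * β)))
    (h : (1 - 15 / 4 * β) * N ≤ T + 37 / 10 * β) :
    N ≤ (1 / 2 + 37 / 10 * (m + 1)) * β / (1 - 15 / 4 * ((m + 1) * β)) := by
  have hE : 0 < 1 - 15 / 4 * (m * β) := by nlinarith
  rw [le_div_iff₀ hE] at hT
  rw [le_div_iff₀ hE']
  have hmβ : 0 ≤ m * β := by positivity
  have h1 := mul_le_mul_of_nonneg_right h hE.le
  have h2 : 1 - 15 / 4 * ((m + 1) * β) ≤ (1 - 15 / 4 * β) * (1 - 15 / 4 * (m * β)) := by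
    nlinarith [mul_nonneg hβ0 hmβ]
  have h3 := mul_le_mul_of_nonneg_left h2 hN
  nlinarith [mul_nonneg hβ0 hmβ]

end numeric

/-! ### Nonvanishing of the denominator -/

section nonvanishing

variable {f : (Fin n → ℂ) → (Fin n → ℂ)} {α : ℝ}

/-- `S` is the set of coordinates switched on so far, and `s` is reserved for the end. The mixed
coefficients serve the remaining disks other than the `s`-th one; the self coefficient is carried
along for the last. -/
lemma invariants_le (hn : 2 ≤ n) (hf : LocallyBiholomorphicOn f (polydisk n)) (h0 : f 0 = 0)
    (h1 : jacobiMatrix f 0 = 1) (hS : schwarzianNorm f ≤ (α : EReal)) {β : ℝ}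
    (hβ : β = Real.sqrt 2 * α) (hβ0 : 0 ≤ β) (hnβ : (n : ℝ) ^ 3 * β ^ 2 ≤ 2 / 37.21) (s : Fin n)
    (S : Finset (Fin n)) : s ∉ S → ∀ z ∈ polydisk n, (∀ i ∉ S, z i = 0) →
      den (linForm (normVec f)) f z ≠ 0 ∧
      (∀ j ∉ S, j ≠ s → ‖mixedInv (linForm (normVec f)) f s j z‖ ≤
        β / (1 - (S.card : ℝ) * (37 / 4 * β))) ∧
      ‖selfInv (linForm (normVec f)) f s z‖ ≤
        (1 / 2 + 37 / 10 * (S.card : ℝ)) * β / (1 - 15 / 4 * ((S.card : ℝ) * β)) := by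
  have hx : (2 : ℝ) ≤ n := by exact_mod_cast hn
  have hb1 := le_of_cube_mul_sq_le hx hnβ
  have hb2 := sub_two_mul_le hx hnβ
  have hb3 := sub_one_mul_le hx hnβ
  induction S using Finset.induction_on with
  | empty =>
    intro _ z _ hz0
    obtain rfl : z = 0 := funext fun i => hz0 i (Finset.notMem_empty i)
    refine ⟨by rw [den_zero _ h0]; exact one_ne_zero, fun j _ hjs => ?_, ?_⟩
    · simpa [hβ] using norm_mixedInv_zero_le hf h0 h1 hS hjs.symm
    · simpa [hβ] using norm_selfInv_zero_le hf h0 h1 hS s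
  | insert k S hkS ih =>
    intro hs z hz hz0
    rw [Finset.mem_insert, not_or] at hs
    obtain ⟨hsk, hsS⟩ := hs
    have hbase : Function.update z k 0 ∈ polydisk n :=
      update_mem_polydisk hz k (mem_ball_self one_pos)
    have hback : Function.update (Function.update z k 0) k (z k) = z := by simp
    obtain ⟨ihD, ihQ, ihT⟩ := ih hsS (Function.update z k 0) hbase fun i hi => by
      rcases eq_or_ne i k with rfl | hik
      · simp
      · rw [Function.update_of_ne hik]
        exact hz0 i (by simp [hik, hi])
    -- Both `s` and the new index `k` lie outside `S`.
    have hcard : (S.card : ℝ) ≤ n - 2 := by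
      have : ({s, k} ∪ S : Finset (Fin n)).card ≤ n := by
        simpa using Finset.card_le_univ ({s, k} ∪ S : Finset (Fin n))
      rw [Finset.card_union_of_disjoint (by simp [hsS, hkS]), Finset.card_pair hsk] at this
      have h2 : ((2 + S.card : ℕ) : ℝ) ≤ n := by exact_mod_cast this
      push_cast at h2
      linarith
    have hm0 : (0 : ℝ) ≤ S.card := Nat.cast_nonneg _
    set m : ℝ := (S.card : ℝ) with hm
    have hmβ : m * β ≤ 0.064 := (mul_le_mul_of_nonneg_right hcard hβ0).trans hb2
    have hmβ' : (m + 1) * β ≤ 0.0893 :=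
      (mul_le_mul_of_nonneg_right (by linarith) hβ0).trans hb3
    have hD : 0 < 1 - m * (37 / 4 * β) := by norm_num at hmβ; linarith
    -- From `0.064 · 37/4 = 0.592` the denominator exceeds `1/3`.
    have hρ : β / (1 - m * (37 / 4 * β)) ≤ 3 * β := by
      rw [div_le_iff₀ hD]
      norm_num at hmβ
      have : 1 ≤ 3 * (1 - m * (37 / 4 * β)) := by linarith
      nlinarith
    have hQk := ihQ k hkS (Ne.symm hsk)
    have hzk : Function.update z k 0 k = 0 := Function.update_self k 0 z
    have hzs : Function.update z k 0 s = 0 := by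
      rw [Function.update_of_ne hsk]
      exact hz0 s (by simp [hsk, hsS])
    have ht : z k ∈ ball (0 : ℂ) 1 := mem_ball_of_mem_polydisk hz k
    rw [Finset.card_insert_of_notMem hkS]
    push_cast
    rw [← hm]
    refine ⟨?_, fun j hj hjs => ?_, ?_⟩
    · rw [← hback]
      refine den_update_ne_zero _ hf hS (hβ ▸ hβ0) (hβ ▸ hb1) hbase hsk hzk ht ihD ?_
      have := hQk.trans hρ
      norm_num at hb1
      linarith
    · rw [Finset.mem_insert, not_or] at hj
      have hzj : Function.update z k 0 j = 0 := by
        rw [Function.update_of_ne hj.1]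
        exact hz0 j (by simp [hj.1, hj.2])
      have hstep := norm_mixedInv_update_le (linForm (normVec f)) hf hS hβ hβ0 hb1 hbase hsk hj.1
        hjs hzk hzj ht ihD hρ hQk (ihQ j hj.2 hjs)
      rw [hback] at hstep
      refine le_div_of_mixed_step hβ0 hm0 (norm_nonneg _) ?_ hstep
      norm_num at hmβ'
      linarith
    · have hstep := norm_selfInv_update_le (linForm (normVec f)) hf hS hβ hβ0 hb1 hbase hsk hzk hzs
        ht ihD (hQk.trans hρ)
      rw [hback] at hstep
      refine le_div_of_self_step hβ0 hm0 (norm_nonneg _) ?_ ihT hstep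
      norm_num at hmβ'
      linarith

/-- If the Schwarzian norm is small, the image of the polydisk does not meet the hyperplane that
the normalization sends to infinity. -/
theorem den_ne_zero (hn : 2 ≤ n) (hf : LocallyBiholomorphicOn f (polydisk n)) (h0 : f 0 = 0)
    (h1 : jacobiMatrix f 0 = 1) (hS : schwarzianNorm f ≤ (α : EReal))
    (hα : (n : ℝ) * Real.sqrt n * α ≤ 1 / 6.1) {z : Fin n → ℂ} (hz : z ∈ polydisk n) :
    den (linForm (normVec f)) f z ≠ 0 := by
  have hα0 : 0 ≤ α := alpha_nonneg hS (by omega)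
  obtain ⟨β, hβ⟩ : ∃ β, β = Real.sqrt 2 * α := ⟨_, rfl⟩
  have hβ0 : 0 ≤ β := by rw [hβ]; positivity
  have hnβ := cube_mul_sq_le (Nat.cast_nonneg n) hα0 hα
  rw [← hβ] at hnβ
  have hx : (2 : ℝ) ≤ n := by exact_mod_cast hn
  have hb1 := le_of_cube_mul_sq_le hx hnβ
  have hb3 := sub_one_mul_le hx hnβ
  set s : Fin n := ⟨0, by omega⟩ with hs
  set r : Fin n := ⟨1, by omega⟩ with hr
  have hrs : r ≠ s := by simp [hr, hs]
  have hbase : Function.update z s 0 ∈ polydisk n :=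
    update_mem_polydisk hz s (mem_ball_self one_pos)
  have hzs : Function.update z s 0 s = 0 := Function.update_self s 0 z
  obtain ⟨hD, -, hT⟩ := invariants_le hn hf h0 h1 hS hβ hβ0 hnβ s (Finset.univ.erase s)
    (Finset.notMem_erase s _) (Function.update z s 0) hbase fun i hi => by
      obtain rfl : i = s := by simpa using hi
      exact hzs
  have hcard : (((Finset.univ.erase s).card : ℕ) : ℝ) = n - 1 := by
    rw [Finset.card_erase_of_mem (Finset.mem_univ s), Finset.card_univ, Fintype.card_fin,
      Nat.cast_sub (by omega), Nat.cast_one]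
  rw [hcard] at hT
  have hd := norm_conn_self_sub_le hf hS hbase hrs
  rw [hzs, norm_zero, ← hβ] at hd
  -- The auxiliary index `r` has already been switched on, so the recursion does not bound this
  -- mixed coefficient; it differs from `selfInv` by half of the controlled combination `Γ^s_ss - 2
  -- Γ^r_rs`.
  have hQ : mixedInv (linForm (normVec f)) f r s (Function.update z s 0) =
      selfInv (linForm (normVec f)) f s (Function.update z s 0) +
        (conn f s s (Function.update z s 0) - 2 * conn f r s (Function.update z s 0)) / 2 := by
    rw [mixedInv, selfInv]; ring
  have hback : Function.update (Function.update z s 0) s (z s) = z := by simp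
  rw [← hback]
  refine den_update_ne_zero _ hf hS (hβ ▸ hβ0) (hβ ▸ hb1) hbase hrs hzs
    (mem_ball_of_mem_polydisk hz s) hD ?_
  -- Uses `(n - 1) β ≤ 0.0893` and `β ≤ 1/12.2`. The value `0.6` suffices since `5/4 (0.6 + 3β/2) <
  -- 1`.
  have hTb : ‖selfInv (linForm (normVec f)) f s (Function.update z s 0)‖ ≤ 0.6 := by
    refine hT.trans ?_
    norm_num at hb3 hb1
    rw [div_le_iff₀ (by linarith)]
    linarith
  have hQb : ‖mixedInv (linForm (normVec f)) f r s (Function.update z s 0)‖ ≤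
      0.6 + 3 / 2 * β := by
    rw [hQ]
    refine (norm_add_le _ _).trans (add_le_add hTb ?_)
    rw [norm_div, Complex.norm_two]
    norm_num at hd
    linarith
  norm_num at hQb hb1
  linarith

end nonvanishing

/-! ### Holomorphy of the normalized map and the omitted hyperplane -/

section normalized

variable {f : (Fin n → ℂ) → (Fin n → ℂ)}

lemma disjoint_hyperplane_iff :
    Disjoint (f '' polydisk n) (hyperplane (normVec f)) ↔
      ∀ z ∈ polydisk n, den (linForm (normVec f)) f z ≠ 0 := by
  rw [Set.disjoint_left]
  simp only [mem_image, forall_exists_index, and_imp, forall_apply_eq_imp_iff₂, den_linForm,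
    hyperplane, mem_ofPred_eq]

lemma differentiableOn_den (A : (Fin n → ℂ) →L[ℂ] ℂ) (hf : DifferentiableOn ℂ f (polydisk n)) :
    DifferentiableOn ℂ (den A f) (polydisk n) :=
  (A.differentiable.comp_differentiableOn hf).const_add 1

lemma normalized_apply (z : Fin n → ℂ) (k : Fin n) :
    normalized f z k = f z k / den (linForm (normVec f)) f z := by
  rw [normalized, moebius, den_linForm]

lemma differentiableOn_normalized (hf : DifferentiableOn ℂ f (polydisk n))
    (h : ∀ z ∈ polydisk n, den (linForm (normVec f)) f z ≠ 0) :
    DifferentiableOn ℂ (normalized f) (polydisk n) := by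
  rw [differentiableOn_pi]
  intro k
  simp only [normalized_apply, div_eq_mul_inv]
  exact (differentiableOn_pi.1 hf k).mul ((differentiableOn_den _ hf).inv h)

/-- At a zero of `D`, `A (f z) = -1`, so `A` is nonzero on some `∂_j f` and the zero is isolated in
the `j`-th direction. Passing to the limit in `f = g D` there gives `f z = 0`, a contradiction; the
value assigned to `g` by division by zero is never used. -/
lemma den_ne_zero_of_differentiableOn_normalized (hf : LocallyBiholomorphicOn f (polydisk n))
    (hg : DifferentiableOn ℂ (normalized f) (polydisk n)) {z : Fin n → ℂ} (hz : z ∈ polydisk n) :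
    den (linForm (normVec f)) f z ≠ 0 := by
  intro h0
  set A := linForm (normVec f) with hA
  have hn := isOpen_polydisk.mem_nhds hz
  have hAf : A (f z) ≠ 0 := by
    intro h
    rw [den, h, add_zero] at h0
    exact one_ne_zero h0
  obtain ⟨j, hj⟩ : ∃ j, A (dirDeriv j f z) ≠ 0 := by
    by_contra! hall
    refine hAf ?_
    rw [← sum_coeff_smul_frame hf hz (f z), map_sum]
    exact Finset.sum_eq_zero fun m _ => by rw [map_smul, hall m, smul_zero]
  have hzz : Function.update z j (z j) = z := Function.update_eq_self j z
  have hd : HasDerivAt (fun t => den A f (Function.update z j t)) (A (dirDeriv j f z)) (z j) := by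
    have h1 := hasDerivAt_dirDeriv (F := f) (z := z) (i := j) (t := z j)
      (by rw [hzz]; exact hf.differentiableOn.differentiableAt hn)
    rw [hzz] at h1
    exact (A.hasFDerivAt.comp_hasDerivAt (z j) h1).const_add 1
  have hne : ∀ᶠ t in 𝓝[≠] (z j), den A f (Function.update z j t) ≠ 0 := by
    have := hd.eventually_ne hj (c := 0)
    simpa using this
  have hcu : Tendsto (fun t => Function.update z j t) (𝓝[≠] (z j)) (𝓝 z) := by
    have := (hasDerivAt_update z j (z j)).continuousAt.tendsto
    rw [hzz] at this
    exact this.mono_left nhdsWithin_le_nhds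
  have hfz : ∀ k, f z k = 0 := by
    intro k
    have hgk : ContinuousAt (fun w => normalized f w k) z :=
      ((differentiableOn_pi.1 hg k).differentiableAt hn).continuousAt
    have hfk : ContinuousAt (fun w => f w k) z :=
      ((differentiableOn_pi.1 hf.differentiableOn k).differentiableAt hn).continuousAt
    have hdk : ContinuousAt (den A f) z :=
      ((differentiableOn_den A hf.differentiableOn).differentiableAt hn).continuousAt
    have h1 := ((hgk.mul hdk).tendsto.comp hcu)
    have h2 := hfk.tendsto.comp hcu
    have h3 := tendsto_nhds_unique_of_eventuallyEq h2 h1 (by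
      filter_upwards [hne] with t ht
      simp only [Function.comp_apply, Pi.mul_apply]
      rw [normalized_apply, div_mul_cancel₀ _ ht])
    rw [h3, Pi.mul_apply, h0, mul_zero]
  refine hAf ?_
  rw [show f z = 0 from funext hfz, map_zero]

end normalized

end PolydiskSchwarzian

end

theorem corollary3p9 (n : ℕ) (hn : 2 ≤ n) (α : ℝ) :
    (∀ f ∈ PolydiskSchwarzian.family n α,
      (DifferentiableOn ℂ (PolydiskSchwarzian.normalized f) (PolydiskSchwarzian.polydisk n) ↔
        Disjoint (f '' PolydiskSchwarzian.polydisk n)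
          (PolydiskSchwarzian.hyperplane (PolydiskSchwarzian.normVec f)))) ∧
    ((n : ℝ) * Real.sqrt n * α ≤ 1 / 6.1 →
      (∀ g ∈ PolydiskSchwarzian.normalizedFamily n α,
        DifferentiableOn ℂ g (PolydiskSchwarzian.polydisk n)) ∧
      (∀ f ∈ PolydiskSchwarzian.family n α,
        Disjoint (f '' PolydiskSchwarzian.polydisk n)
          (PolydiskSchwarzian.hyperplane (PolydiskSchwarzian.normVec f)))) := by
  open PolydiskSchwarzian in
  have main : (n : ℝ) * Real.sqrt n * α ≤ 1 / 6.1 → ∀ f ∈ family n α,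
      ∀ z ∈ polydisk n, den (linForm (normVec f)) f z ≠ 0 := fun hα f hf z hz =>
    den_ne_zero hn hf.1 hf.2.1 hf.2.2.1 hf.2.2.2 hα hz
  refine ⟨fun f hf => ?_, fun hα => ⟨?_, fun f hf => ?_⟩⟩
  · rw [PolydiskSchwarzian.disjoint_hyperplane_iff]
    exact ⟨fun hg z hz =>
      PolydiskSchwarzian.den_ne_zero_of_differentiableOn_normalized hf.1 hg hz,
      PolydiskSchwarzian.differentiableOn_normalized hf.1.differentiableOn⟩
  · rintro g ⟨f, hf, hgf⟩
    exact (PolydiskSchwarzian.differentiableOn_normalized hf.1.differentiableOn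
      (main hα f hf)).congr hgf
  · exact PolydiskSchwarzian.disjoint_hyperplane_iff.2 (main hα f hf)
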